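/- Let $\mathbb F_q$ be a finite field and $G=\mathrm{PGL}_2(\mathbb F_q)$. Let $U\cong\mathbb F_q$ be the subgroup of unipotent upper triangular matrices, $S$ the subgroup of diagonal matrices, and $T$ a non-split maximal torus of $G$, i.e. $T=K^\times/\mathbb F_q^\times$ for a subalgebra $K\subset M_2(\mathbb F_q)$ that is a field of degree $2$ over $\mathbb F_q$. Let $S'$ and $T'$ be the normalizers of $S$ and $T$ in $G$. All representations are finite-dimensional over $\mathbb C$. An irreducible representation of $G$ is called generic if its restriction to $U$ contains a nontrivial character of $U$. Let $\mathrm{St}$ be the Steinberg representation of $G$, i.e. the kernel of the augmentation on the permutation representation $\mathbb C[G/B]$, where $B=US$. For an irreducible generic representation $\pi$ of $G$, denote by $\pi^{S'}$ and $\pi^{T'}$ representations of $S'$ and $T'$ with $$\pi|_S\cong \mathbb C[S]\oplus \pi^{S'}|_S,\qquad \pi|_T\oplus\pi^{T'}|_T\cong\mathbb C[T]$$ (regular representations) such that moreover, if $\pi\cong\mathrm{St}\otimes(\eta\circ\det)$ for a character $\eta$ of $\mathbb F_q^\times$ with $\eta^2=1$, then $\pi^{S'}\cong(\eta\circ\det)|_{S'}$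 and $\pi^{T'}\cong(\eta\circ\det)|_{T'}$. Theorem. Let $\pi_1,\pi_2,\pi_3$ be irreducible generic representations of $G$. Then representations $\pi_i^{S'}$ and $\pi_i^{T'}$ as above exist for $i=1,2,3$, and, for every choice of them, $$m_G-m_{S'}+m_{T'}=1,$$ where $m_H=\dim(\pi_1^H\otimes\pi_2^H\otimes\pi_3^H)^H$ for $H\in\{G,S',T'\}$, with $\pi_i^G=\pi_i$. -/

import Mathlib

open scoped MatrixGroups TensorProduct

noncomputable section

namespace FinitePGLTwo

open Matrix Representation

variable (F : Type*) [Field F]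

/-- The image in `PGL₂(F)` of the group of units of a subalgebra of the `2 × 2` matrices. -/
def unitsImage {F : Type*} [Field F] (K : Subalgebra F (Matrix (Fin 2) (Fin 2) F)) :
    Subgroup PGL(2, F) :=
  (K.toSubmonoid.units : Subgroup (GL (Fin 2) F)).map ProjGenLinGroup.mk

/-- The split torus `S`: the subgroup of diagonal matrices of `PGL₂(F)`. -/
def splitTorus : Subgroup PGL(2, F) :=
  unitsImage (Matrix.diagonalAlgHom (n := Fin 2) (α := F) F).range

/-- `T` is a non-split maximal torus of `PGL₂(F)`: the image of `Kˣ`, where `K` is a subalgebra of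
the `2 × 2` matrices that is a quadratic field extension of `F`, i.e. `T = Kˣ / Fˣ`. -/
def IsNonsplitTorus {F : Type*} [Field F] (T : Subgroup PGL(2, F)) : Prop :=
  ∃ K : Subalgebra F (Matrix (Fin 2) (Fin 2) F),
    IsField K ∧ Module.finrank F K = 2 ∧ T = unitsImage K

/-- The class in `PGL₂(F)` of the unipotent matrix `!![1, x; 0, 1]`; these form the group `U`. -/
def unip {F : Type*} [Field F] (x : F) : PGL(2, F) :=
  ProjGenLinGroup.mk (GeneralLinearGroup.upperRightHom x)

/-- The invertible upper triangular matrices. -/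
def upperTriangularGL : Subgroup (GL (Fin 2) F) where
  carrier := {g | g.val 1 0 = 0}
  one_mem' := by simp
  mul_mem' {a b} ha hb := by
    simp only [Set.mem_ofPred_eq] at ha hb ⊢
    simp [Matrix.mul_apply, Fin.sum_univ_two, ha, hb]
  inv_mem' {a} ha := by
    simp only [Set.mem_ofPred_eq] at ha ⊢
    simp [Matrix.coe_units_inv, Matrix.inv_def, Matrix.adjugate_fin_two, ha]

/-- The Borel subgroup `B` of `PGL₂(F)`. -/
def borel : Subgroup PGL(2, F) := (upperTriangularGL F).map ProjGenLinGroup.mk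

/-- A one-dimensional character, as a representation on `ℂ`. -/
def charRep {H : Type*} [Group H] (χ : H →* ℂˣ) : Representation ℂ H ℂ :=
  (algebraMap ℂ (Module.End ℂ ℂ)).toMonoidHom.comp ((Units.coeHom ℂ).comp χ)

/-- The character `η ∘ det` of `PGL₂(F)`, for a character `η` of `Fˣ` with `η ^ 2 = 1`. -/
def detChar {F : Type*} [Field F] (η : Fˣ →* ℂˣ) (hη : η ^ 2 = 1) : PGL(2, F) →* ℂˣ :=
  ProjGenLinGroup.lift (η.comp GeneralLinearGroup.det) <| by
    ext u
    have h := DFunLike.congr_fun hη u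
    simp only [MonoidHom.pow_apply, MonoidHom.one_apply] at h
    simp [h]

/-- The augmentation (sum of the coefficients) on the permutation module of `X`. -/
def augmentation (X : Type*) : MonoidAlgebra ℂ X →ₗ[ℂ] ℂ :=
  Finsupp.linearCombination ℂ (fun _ : X => (1 : ℂ)) ∘ₗ
    (MonoidAlgebra.coeffLinearEquiv ℂ).toLinearMap

lemma augmentation_ofMulAction {G X : Type*} [Group G] [MulAction G X] (g : G)
    (f : MonoidAlgebra ℂ X) :
    augmentation X (Representation.ofMulAction ℂ G X g f) = augmentation X f := by
  simp [augmentation, Representation.ofMulAction_def, Finsupp.lmapDomain_apply,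
    Finsupp.linearCombination_mapDomain, Function.comp_def]

/-- The Steinberg representation of `PGL₂(F)` (for `F` finite): the augmentation kernel in the
permutation representation on `G ⧸ B`, the projective line. -/
def steinberg : Representation ℂ PGL(2, F)
    (LinearMap.ker (augmentation (PGL(2, F) ⧸ borel F))) :=
  (Representation.ofMulAction ℂ PGL(2, F) (PGL(2, F) ⧸ borel F)).subrepresentation _
    fun g f hf => by
      rw [LinearMap.mem_ker] at hf
      rw [Submodule.mem_comap, LinearMap.mem_ker, augmentation_ofMulAction, hf]

variable {F}

/-- `π` is generic: its restriction to `U` contains a nontrivial character of `U ≃ F`. -/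
def IsGeneric {V : Type*} [AddCommGroup V] [Module ℂ V] (π : Representation ℂ PGL(2, F) V) :
    Prop :=
  ∃ ψ : AddChar F ℂ, ψ ≠ 1 ∧ ∃ v : V, v ≠ 0 ∧ ∀ x : F, π (unip x) v = ψ x • v

/-- `π` is isomorphic to the twist `St ⊗ (η ∘ det)` of the Steinberg representation. -/
def IsSteinbergTwist {V : Type*} [AddCommGroup V] [Module ℂ V]
    (π : Representation ℂ PGL(2, F) V) (η : Fˣ →* ℂˣ) (hη : η ^ 2 = 1) : Prop :=
  Nonempty (π.Equiv ((steinberg F).tprod (charRep (detChar η hη))))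

/-- The restriction of a representation to a subgroup. -/
abbrev res {G V : Type*} [Group G] [AddCommGroup V] [Module ℂ V] (π : Representation ℂ G V)
    (H : Subgroup G) : Representation ℂ H V :=
  π.comp H.subtype

/-- The restriction to `H` of a representation of the normalizer of `H`. -/
abbrev resNormalizer {G W : Type*} [Group G] [AddCommGroup W] [Module ℂ W] {H : Subgroup G}
    (σ : Representation ℂ (Subgroup.normalizer (H : Set G)) W) : Representation ℂ H W :=
  σ.comp (Subgroup.inclusion Subgroup.le_normalizer)

/-- In the situation where `π` is a twist `St ⊗ (η ∘ det)` of the Steinberg representation, `σ` is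
the restriction of `η ∘ det` to `N`. There is no condition for other `π`. -/
def SteinbergNormalized {V W : Type*} [AddCommGroup V] [Module ℂ V] [AddCommGroup W] [Module ℂ W]
    (π : Representation ℂ PGL(2, F) V) {N : Subgroup PGL(2, F)} (σ : Representation ℂ N W) : Prop :=
  ∀ (η : Fˣ →* ℂˣ) (hη : η ^ 2 = 1), IsSteinbergTwist π η hη →
    Nonempty (σ.Equiv (charRep ((detChar η hη).comp N.subtype)))

/-- `σ` is (a model of) the representation `π^{S'}` of the normalizer `S'` of the split torus `S`
associated with the irreducible generic representation `π`: the restriction of `π` to `S` is the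
sum of the regular representation of `S` and of the restriction of `σ`. If `π = St ⊗ (η ∘ det)`,
this determines only the restriction of `σ` to `S`, and the extension to `S'` is `η ∘ det`. -/
structure IsAssociatedSplit {V W : Type*} [AddCommGroup V] [Module ℂ V] [AddCommGroup W]
    [Module ℂ W] (π : Representation ℂ PGL(2, F) V)
    (σ : Representation ℂ (Subgroup.normalizer (splitTorus F : Set PGL(2, F))) W) : Prop where
  restriction : Nonempty ((res π (splitTorus F)).Equiv
    ((Representation.leftRegular ℂ (splitTorus F)).prod (resNormalizer σ)))
  normalized : SteinbergNormalized π σ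

/-- `τ` is (a model of) the representation `π^{T'}` of the normalizer `T'` of the non-split torus
`T` associated with the irreducible generic representation `π`: the sum of the restrictions of `π`
and `τ` to `T` is the regular representation of `T`. If `π = St ⊗ (η ∘ det)`, this determines only
the restriction of `τ` to `T`, and the extension to `T'` is `η ∘ det`. -/
structure IsAssociatedNonsplit {V W : Type*} [AddCommGroup V] [Module ℂ V] [AddCommGroup W]
    [Module ℂ W] {T : Subgroup PGL(2, F)} (π : Representation ℂ PGL(2, F) V)
    (τ : Representation ℂ (Subgroup.normalizer (T : Set PGL(2, F))) W) : Prop where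
  restriction : Nonempty (((res π T).prod (resNormalizer τ)).Equiv
    (Representation.leftRegular ℂ T))
  normalized : SteinbergNormalized π τ

/-- `dim (ρ₁ ⊗ ρ₂ ⊗ ρ₃)^H`. -/
def tripleMult {H : Type*} [Group H] {V₁ V₂ V₃ : Type*} [AddCommGroup V₁] [Module ℂ V₁]
    [AddCommGroup V₂] [Module ℂ V₂] [AddCommGroup V₃] [Module ℂ V₃]
    (ρ₁ : Representation ℂ H V₁) (ρ₂ : Representation ℂ H V₂) (ρ₃ : Representation ℂ H V₃) : ℕ :=
  Module.finrank ℂ (Representation.invariants ((ρ₁.tprod ρ₂).tprod ρ₃))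

end FinitePGLTwo

end

noncomputable section

namespace FinitePGLTwo

open Matrix Representation

/-! ### Characters of complex representations, and Maschke's theorem. -/

section Characters

variable {G V W : Type*} [Group G] [AddCommGroup V] [Module ℂ V] [AddCommGroup W] [Module ℂ W]

/-! Write q for the order of `F`, u for a nontrivial element of U, and m for the multiplicity in π
of a nontrivial character of U. The nontrivial elements of U form a single G-orbit under
conjugation, so π(1) = mq + π(u). Let k be the character of π on S minus m regular characters, and l
be m regular characters minus the character of π on T; this is what `TorusData` records. Every
nontrivial element of G is conjugate into exactly one of U, S, T, so a sum over G reduces to u and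
the two tori (`sum_classFunction`).

The regular characters are chosen so that the terms at 1 and u cancel in a pairing: the average of f
f' over G is half the sum of the averages of k k' over S and l l' over T (`TorusData.average_mul`).
For three factors with m = 1 the same computation leaves exactly 1, and the three signs of l
multiply to a minus: m_G = 1 + (A_S - A_T)/2, where A_S and A_T are the averages of the triple
products of the k's and of the l's (`TorusData.average_mul_mul`). This 1 is the one in the theorem.

The pairing formula also classifies generic π without constructing any of them
(`exists_genericType`). The Fourier coefficients of k and l are integers with sum k(1) + l(1) = 2m,
and irreducibility makes the sum of their squares 2. Since x² ≥ x on integers, m = 1 and all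
coefficients are 0 or 1, so (k(1), l(1)) is (2, 0), (1, 1) or (0, 2). Orthogonality to η ∘ det says
that k and l contain the restrictions of η ∘ det equally often. Hence the cases are k = χ + χ⁻¹ with
l = 0, or k and l both restrictions of one η ∘ det, or k = 0 with l = χ + χ⁻¹, always with χ² ≠ 1.
The middle case is the Steinberg twist (`TorusData.isSteinbergTwist`).

It remains to see that m_{S'} and m_{T'} are A_S/2 and A_T/2 up to a common error
(`exists_tripleMult_normalizer`). The error is the contribution of the nontrivial coset of the
torus. If some π_i is not a Steinberg twist, its associated characters vanish on that coset, being
zero or lying over χ + χ⁻¹ with χ² ≠ 1. If all three are twists by η_i, both errors are 1/2 or 0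
according to whether the product of the η_i is trivial. -/

lemma character_prod [FiniteDimensional ℂ V] [FiniteDimensional ℂ W]
    (ρ : Representation ℂ G V) (σ : Representation ℂ G W) :
    (ρ.prod σ).character = ρ.character + σ.character := by
  ext g
  exact LinearMap.trace_prodMap' (ρ g) (σ g)

lemma character_charRep (χ : G →* ℂˣ) (g : G) : (charRep χ).character g = χ g := by
  have : charRep χ g = ((χ g : ℂˣ) : ℂ) • (1 : Module.End ℂ ℂ) := by
    ext; simp [charRep]
  simp [character, this]

lemma character_ofMulAction {X : Type*} [MulAction G X] [Finite X] (g : G) :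
    (ofMulAction ℂ G X).character g = Nat.card (MulAction.fixedBy X g) := by
  classical
  have := Fintype.ofFinite X
  rw [character, LinearMap.trace_eq_matrix_trace ℂ (MonoidAlgebra.basis X ℂ), Matrix.trace,
    Nat.card_eq_fintype_card, Fintype.card_subtype, Finset.card_filter]
  push_cast
  refine Finset.sum_congr rfl fun x _ => ?_
  rw [Matrix.diag_apply, LinearMap.toMatrix_apply, MonoidAlgebra.basis_apply, ofMulAction_single]
  change (Finsupp.single (g • x) (1 : ℂ)) x = _
  simp [Finsupp.single_apply]

lemma character_leftRegular [Finite G] [DecidableEq G] (g : G) :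
    (leftRegular ℂ G).character g = if g = 1 then (Nat.card G : ℂ) else 0 := by
  rw [character_ofMulAction]
  split_ifs with h
  · subst h
    have : MulAction.fixedBy G (1 : G) = Set.univ := by ext; simp
    rw [this, Nat.card_congr (Equiv.Set.univ G)]
  · have : MulAction.fixedBy G g = ∅ := by
      ext x
      simp [MulAction.mem_fixedBy, h]
    rw [this]
    simp

instance [Finite G] : NeZero (Nat.card G : ℂ) := ⟨Nat.cast_ne_zero.2 Nat.card_pos.ne'⟩

lemma average_character [Fintype G] [FiniteDimensional ℂ V] (ρ : Representation ℂ G V) :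
    (Nat.card G : ℂ)⁻¹ * ∑ g, ρ.character g = Module.finrank ℂ ρ.invariants := by
  have := invertibleOfNonzero (NeZero.ne (Nat.card G : ℂ))
  exact card_inv_mul_sum_char_eq_finrank ρ

lemma average_character_mul [Fintype G] [FiniteDimensional ℂ V] [FiniteDimensional ℂ W]
    (ρ : Representation ℂ G V) (σ : Representation ℂ G W) :
    (Nat.card G : ℂ)⁻¹ * ∑ g, σ.character g * ρ.character g⁻¹ =
      Module.finrank ℂ (IntertwiningMap ρ σ) := by
  have := invertibleOfNonzero (NeZero.ne (Nat.card G : ℂ))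
  exact card_inv_mul_sum_char_mul_char_eq_finrank ρ σ

/-- Maschke's theorem gives an equivariant retraction `r` of `f`, and the kernel of `r` is the
complement. -/
lemma exists_equiv_prod_of_injective [Finite G] {ρ : Representation ℂ G V}
    {σ : Representation ℂ G W} (f : IntertwiningMap ρ σ) (hf : Function.Injective f) :
    ∃ (C : Submodule ℂ W) (τ : Representation ℂ G C) (e : σ.Equiv (ρ.prod τ)),
      ∀ v, e (f v) = (v, 0) := by
  obtain ⟨p, hp⟩ := MonoidAlgebra.exists_leftInverse_of_injective
    (IntertwiningMap.equivLinearMapAsModule ρ σ f) (LinearMap.ker_eq_bot.2 hf)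
  obtain ⟨r, rfl⟩ := (IntertwiningMap.equivLinearMapAsModule σ ρ).surjective p
  have hr : ∀ v, r (f v) = v := fun v => DFunLike.congr_fun hp v
  have hr' : ∀ g w, r (σ g w) = ρ g (r w) := fun g w => r.isIntertwining _ _ g w
  have hf' : ∀ g v, f (ρ g v) = σ g (f v) := fun g w => f.isIntertwining _ _ g w
  let e : W ≃ₗ[ℂ] V × r.ker.toSubmodule :=
    { toFun := fun w => (r w, ⟨w - f (r w), by
        change r (w - f (r w)) = 0
        rw [map_sub, hr, sub_self]⟩)
      map_add' := fun x y => by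
        ext
        · simp
        · simp only [map_add, Prod.snd_add, Submodule.coe_add]; abel
      map_smul' := fun c x => by
        ext
        · simp
        · simp [smul_sub]
      invFun := fun x => f x.1 + x.2
      left_inv := fun w => by simp
      right_inv := fun x => by
        have h0 : r (x.2 : W) = 0 := x.2.2
        ext
        · simp [hr, h0]
        · simp [hr, h0] }
  refine ⟨r.ker.toSubmodule, r.ker.toRepresentation, Representation.Equiv.mk e fun g => ?_, fun v => ?_⟩
  · ext w
    · exact hr' g w
    · change σ g w - f (r (σ g w)) = σ g (w - f (r w))
      rw [hr', hf', map_sub]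
  · change (r (f v), (⟨f v - f (r (f v)), _⟩ : r.ker.toSubmodule)) = _
    ext
    · exact hr v
    · simp [hr v]

lemma equiv_prod_congr {V' W' : Type*} [AddCommGroup V'] [Module ℂ V'] [AddCommGroup W']
    [Module ℂ W'] {ρ : Representation ℂ G V} {ρ' : Representation ℂ G V'}
    {σ : Representation ℂ G W} {σ' : Representation ℂ G W'} (e : ρ.Equiv ρ') (f : σ.Equiv σ') :
    Nonempty ((ρ.prod σ).Equiv (ρ'.prod σ')) := by
  refine ⟨Representation.Equiv.mk (e.toLinearEquiv.prodCongr f.toLinearEquiv) fun g => ?_⟩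
  refine LinearMap.ext fun x => Prod.ext ?_ ?_
  · exact e.toIntertwiningMap.isIntertwining _ _ g x.1
  · exact f.toIntertwiningMap.isIntertwining _ _ g x.2

lemma equiv_prod_comm (ρ : Representation ℂ G V) (σ : Representation ℂ G W) :
    Nonempty ((ρ.prod σ).Equiv (σ.prod ρ)) :=
  ⟨Representation.Equiv.mk (LinearEquiv.prodComm ℂ V W) fun _ => LinearMap.ext fun _ => rfl⟩

lemma character_eq_zero_of_subsingleton [Subsingleton V] (ρ : Representation ℂ G V) (g : G) :
    ρ.character g = 0 := by
  rw [character, Subsingleton.elim (ρ g) 0, map_zero]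

end Characters

/-- Finite-dimensional complex representations of a finite group with equal characters are
isomorphic. -/
theorem equiv_of_character_eq.{u, v, w} {G : Type u} [Group G] [Finite G] {V : Type v}
    [AddCommGroup V] [Module ℂ V] [FiniteDimensional ℂ V] {W : Type w} [AddCommGroup W]
    [Module ℂ W] [FiniteDimensional ℂ W] (ρ : Representation ℂ G V) (σ : Representation ℂ G W)
    (h : ρ.character = σ.character) : Nonempty (ρ.Equiv σ) := by
  suffices H : ∀ n : ℕ, ∀ (V : Type v) [AddCommGroup V] [Module ℂ V] [FiniteDimensional ℂ V]
      (W : Type w) [AddCommGroup W] [Module ℂ W] [FiniteDimensional ℂ W]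
      (ρ : Representation ℂ G V) (σ : Representation ℂ G W), Module.finrank ℂ V = n →
      ρ.character = σ.character → Nonempty (ρ.Equiv σ) from H _ V W ρ σ rfl h
  have := Fintype.ofFinite G
  intro n
  induction n using Nat.strong_induction_on with
  | _ n ih =>
  intro V _ _ _ W _ _ _ ρ σ hn h
  have hdim : Module.finrank ℂ V = Module.finrank ℂ W := by
    have := congr_fun h 1
    rw [char_one, char_one] at this
    exact_mod_cast this
  rcases Nat.eq_zero_or_pos n with rfl | hpos
  · have := Module.finrank_zero_iff.1 hn
    have := Module.finrank_zero_iff.1 (hdim ▸ hn)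
    exact ⟨Representation.Equiv.mk (LinearEquiv.ofFinrankEq V W hdim) fun g => LinearMap.ext fun x =>
      Subsingleton.elim _ _⟩
  obtain ⟨f, hf⟩ : ∃ f : IntertwiningMap ρ σ, f ≠ 0 := by
    -- The dimension of a Hom space depends only on the characters, so Hom(ρ, σ) is as large as End
    -- ρ, which contains the identity.
    have h1 : Module.finrank ℂ (IntertwiningMap ρ σ) = Module.finrank ℂ (IntertwiningMap ρ ρ) := by
      have h1 := average_character_mul ρ σ
      rw [← h, average_character_mul ρ ρ] at h1
      exact_mod_cast h1.symm
    have : Nontrivial V := Module.nontrivial_of_finrank_pos (R := ℂ) (by omega)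
    have : Nontrivial (IntertwiningMap ρ ρ) := by
      obtain ⟨v, hv⟩ := exists_ne (0 : V)
      exact ⟨IntertwiningMap.id ρ, 0, fun h => hv (by simpa using DFunLike.congr_fun h v)⟩
    have := Module.finrank_pos (R := ℂ) (M := IntertwiningMap ρ ρ)
    have : Nontrivial (IntertwiningMap ρ σ) :=
      Module.nontrivial_of_finrank_pos (R := ℂ) (by omega)
    exact exists_ne 0
  -- A complement C of the kernel of `f` embeds in σ. Splitting C off on both sides leaves the
  -- kernel and a complement D with equal characters, to which induction on the dimension applies.
  let ι : IntertwiningMap f.ker.toRepresentation ρ := ⟨f.ker.toSubmodule.subtype, fun _ => rfl⟩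
  obtain ⟨C, τ, e, he⟩ := exists_equiv_prod_of_injective ι Subtype.val_injective
  let j : IntertwiningMap τ σ :=
    (f.comp e.symm.toIntertwiningMap).comp (IntertwiningMap.inr ℂ f.ker.toRepresentation τ)
  have hj : Function.Injective j := by
    rw [injective_iff_map_eq_zero]
    intro c hc
    have hc' : f (e.symm (0, c)) = 0 := hc
    have h1 := he ⟨e.symm (0, c), hc'⟩
    have h2 : e (e.symm (0, c)) = (⟨e.symm (0, c), hc'⟩, 0) := h1
    rw [e.apply_symm_apply] at h2
    exact congr_arg Prod.snd h2
  obtain ⟨D, υ, e', -⟩ := exists_equiv_prod_of_injective j hj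
  have hlt : Module.finrank ℂ f.ker.toSubmodule < n := by
    rw [← hn]
    refine Submodule.finrank_lt fun htop => hf ?_
    ext v
    have : v ∈ f.ker.toSubmodule := htop ▸ Submodule.mem_top
    exact this
  have hchar : f.ker.toRepresentation.character = υ.character := by
    have h1 := char_iso e
    have h2 := char_iso e'
    rw [character_prod] at h1 h2
    rw [h, h2, add_comm] at h1
    exact (add_right_cancel h1).symm
  obtain ⟨ε⟩ := ih _ hlt _ _ _ _ rfl hchar
  obtain ⟨ε₁⟩ := equiv_prod_congr ε (Representation.Equiv.refl τ)
  obtain ⟨ε₂⟩ := equiv_prod_comm υ τ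
  exact ⟨((e.trans ε₁).trans ε₂).trans e'.symm⟩

/-! ### Models on coordinate spaces. -/

section Transport

variable {G V : Type*} [Group G] [AddCommGroup V] [Module ℂ V] [FiniteDimensional ℂ V]

lemma exists_equiv_fin (ρ : Representation ℂ G V) :
    ∃ (n : ℕ) (σ : Representation ℂ G (Fin n → ℂ)), Nonempty (ρ.Equiv σ) := by
  let e := (Module.finBasis ℂ V).equivFun
  refine ⟨_, e.conjRingEquiv.toMonoidHom.comp ρ, ⟨Representation.Equiv.mk e fun g => ?_⟩⟩
  ext v : 1
  simp [LinearEquiv.conjRingEquiv]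

end Transport

/-! ### Fourier analysis on finite abelian groups. -/

section Fourier

variable {A : Type*} [Group A]

instance [Finite A] : Finite (A →* ℂˣ) := by
  have hroot : ∀ (χ : A →* ℂˣ) (a : A), χ a ∈ rootsOfUnity (Nat.card A) ℂ := fun χ a => by
    rw [mem_rootsOfUnity, ← map_pow, pow_card_eq_one', map_one]
  have _ : NeZero (Nat.card A) := ⟨Nat.card_pos.ne'⟩
  refine Finite.of_injective
    (fun (χ : A →* ℂˣ) (a : A) => (⟨χ a, hroot χ a⟩ : rootsOfUnity (Nat.card A) ℂ)) fun χ χ' h => ?_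
  ext a
  exact congr_arg (fun x : rootsOfUnity (Nat.card A) ℂ => ((x : ℂˣ) : ℂ)) (congr_fun h a)

instance [Finite A] : Fintype (A →* ℂˣ) := Fintype.ofFinite _

lemma card_dual [Finite A] [IsMulCommutative A] : Nat.card (A →* ℂˣ) = Nat.card A := by
  open scoped IsMulCommutative in
  have : NeZero (Monoid.exponent A : ℂ) := ⟨by
    exact_mod_cast Monoid.exponent_ne_zero_of_finite⟩
  exact CommGroup.card_monoidHom_of_hasEnoughRootsOfUnity A ℂ

variable [Fintype A]

open scoped Classical in
lemma sum_hom_units (χ : A →* ℂˣ) :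
    ∑ a, (χ a : ℂ) = if χ = 1 then (Nat.card A : ℂ) else 0 := by
  split_ifs with h
  · simp [h, Nat.card_eq_fintype_card]
  · have := sum_hom_units_eq_zero ((Units.coeHom ℂ).comp χ) fun h' => h (by
      ext a; simpa using DFunLike.congr_fun h' a)
    simpa using this

lemma sum_dual_apply_of_ne [IsMulCommutative A] {a : A} (ha : a ≠ 1) :
    ∑ χ : A →* ℂˣ, (χ a : ℂ) = 0 := by
  open scoped IsMulCommutative in
  have : NeZero (Monoid.exponent A : ℂ) := ⟨by
    exact_mod_cast Monoid.exponent_ne_zero_of_finite⟩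
  obtain ⟨φ, hφ⟩ := CommGroup.exists_apply_ne_one_of_hasEnoughRootsOfUnity A ℂ ha
  have := sum_hom_units_eq_zero ((Units.coeHom ℂ).comp (MonoidHom.eval a : (A →* ℂˣ) →* ℂˣ))
    fun h' => hφ (by
      have := DFunLike.congr_fun h' φ
      simpa using this)
  simpa using this

/-- The Fourier coefficient of `f` at the character `χ`. -/
def fourierCoeff (f : A → ℂ) (χ : A →* ℂˣ) : ℂ :=
  (Nat.card A : ℂ)⁻¹ * ∑ a, f a * (χ a⁻¹ : ℂˣ)

open scoped Classical in
lemma sum_fourierCoeff_mul [IsMulCommutative A] (f : A → ℂ) (a : A) :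
    ∑ χ, fourierCoeff f χ * (χ a : ℂˣ) = f a := by
  have h0 : (Nat.card A : ℂ) ≠ 0 := NeZero.ne _
  have h1 : ∀ b, ∑ χ : A →* ℂˣ, ((χ b⁻¹ : ℂˣ) : ℂ) * (χ a : ℂˣ)
      = if b = a then (Nat.card A : ℂ) else 0 := by
    intro b
    have : ∀ χ : A →* ℂˣ, ((χ b⁻¹ : ℂˣ) : ℂ) * (χ a : ℂˣ) = (χ (b⁻¹ * a) : ℂˣ) := by
      intro χ; simp
    simp_rw [this]
    split_ifs with h
    · subst h
      simp [← Nat.card_eq_fintype_card, card_dual]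
    · exact sum_dual_apply_of_ne fun h' => h (inv_mul_eq_one.1 h')
  simp_rw [fourierCoeff, mul_assoc, Finset.sum_mul, ← Finset.mul_sum]
  rw [Finset.sum_comm]
  simp_rw [mul_assoc, ← Finset.mul_sum, h1]
  simp only [mul_ite, mul_zero, Finset.sum_ite_eq', Finset.mem_univ, if_true]
  field_simp

/-- Plancherel, with inversion of the argument in place of complex conjugation, so that no conjugate
coefficients appear. -/
lemma average_mul_inv [IsMulCommutative A] (f g : A → ℂ) :
    (Nat.card A : ℂ)⁻¹ * ∑ a, f a * g a⁻¹ = ∑ χ, fourierCoeff f χ * fourierCoeff g χ := by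
  simp_rw [← sum_fourierCoeff_mul g _⁻¹, Finset.mul_sum]
  rw [Finset.sum_comm]
  refine Finset.sum_congr rfl fun χ _ => ?_
  generalize fourierCoeff g χ = c
  rw [← Finset.mul_sum, fourierCoeff, mul_assoc, Finset.sum_mul]
  congr 1
  exact Finset.sum_congr rfl fun a _ => by ring

lemma fourierCoeff_sub (f g : A → ℂ) (χ : A →* ℂˣ) :
    fourierCoeff (f - g) χ = fourierCoeff f χ - fourierCoeff g χ := by
  simp [fourierCoeff, sub_mul, Finset.sum_sub_distrib, mul_sub]

lemma fourierCoeff_neg (f : A → ℂ) (χ : A →* ℂˣ) :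
    fourierCoeff (-f) χ = -fourierCoeff f χ := by
  simp [fourierCoeff]

/-- The function is c times the regular character, which contains every character once. Thus
subtracting m regular characters keeps the coefficients integral. -/
lemma fourierCoeff_single [DecidableEq A] (c : ℂ) (χ : A →* ℂˣ) :
    fourierCoeff (fun a => if a = 1 then Nat.card A * c else 0) χ = c := by
  have h0 : (Nat.card A : ℂ) ≠ 0 := NeZero.ne _
  simp [fourierCoeff]

open scoped Classical in
lemma fourierCoeff_hom (χ' χ : A →* ℂˣ) :
    fourierCoeff (fun a => (χ' a : ℂ)) χ = if χ' = χ then 1 else 0 := by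
  have h0 : (Nat.card A : ℂ) ≠ 0 := NeZero.ne _
  have : ∀ a, (χ' a : ℂ) * (χ a⁻¹ : ℂˣ) = ((χ' * χ⁻¹) a : ℂˣ) := fun a => by simp
  rw [fourierCoeff, Finset.sum_congr rfl fun a _ => this a, sum_hom_units]
  by_cases h : χ' = χ
  · subst h
    rw [if_pos rfl, if_pos (mul_inv_cancel χ'), inv_mul_cancel₀ h0]
  · rw [if_neg h, if_neg fun h' => h (_root_.mul_inv_eq_one.1 h'), mul_zero]

lemma fourierCoeff_inv [IsMulCommutative A] (f : A → ℂ) (hf : ∀ a, f a⁻¹ = f a) (χ : A →* ℂˣ) :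
    fourierCoeff f χ⁻¹ = fourierCoeff f χ := by
  rw [fourierCoeff, fourierCoeff, ← _root_.Equiv.sum_comp (Equiv.inv A)]
  congr 1
  exact Finset.sum_congr rfl fun a _ => by simp [hf]

/-- The coefficient is the dimension of the invariants of ρ ⊗ χ⁻¹. -/
lemma fourierCoeff_character {V : Type*} [AddCommGroup V] [Module ℂ V] [FiniteDimensional ℂ V]
    (ρ : Representation ℂ A V) (χ : A →* ℂˣ) :
    ∃ n : ℕ, fourierCoeff ρ.character χ = n := by
  refine ⟨_, Eq.trans ?_ (average_character (ρ.tprod (charRep χ⁻¹)))⟩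
  simp [fourierCoeff, character_charRep]

end Fourier

/-! ### Tori inverted by a Weyl element, and their normalizers. -/

/-- Abstract properties of a maximal torus `H` in `PGL₂` of a field, with a Weyl element `w`. -/
structure IsDihedralTorus {G : Type*} [Group G] (H : Subgroup G) (w : G) : Prop where
  comm : ∀ a ∈ H, ∀ b ∈ H, a * b = b * a
  w_mul_w : w * w = 1
  w_notMem : w ∉ H
  conj : ∀ h ∈ H, w * h * w = h⁻¹
  fusion : ∀ h ∈ H, h ≠ 1 → ∀ g, g⁻¹ * h * g ∈ H → g ∈ H ∨ g * w ∈ H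

namespace IsDihedralTorus

variable {G : Type*} [Group G] {H : Subgroup G} {w : G} (hH : IsDihedralTorus H w)

include hH

lemma isMulCommutative : IsMulCommutative H :=
  ⟨⟨fun a b => Subtype.ext (hH.comm a a.2 b b.2)⟩⟩

lemma w_inv : w⁻¹ = w := inv_eq_of_mul_eq_one_left hH.w_mul_w

lemma notMem_of_mul_mem {g : G} (hg : g * w ∈ H) : g ∉ H := fun h =>
  hH.w_notMem ((H.mul_mem_cancel_left h).1 hg)

lemma conj_mem_iff {h : G} (hh : h ∈ H) (h1 : h ≠ 1) (g : G) :
    g⁻¹ * h * g ∈ H ↔ g ∈ H ∨ g * w ∈ H := by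
  refine ⟨hH.fusion h hh h1 g, ?_⟩
  rintro (hg | hg)
  · exact H.mul_mem (H.mul_mem (H.inv_mem hg) hh) hg
  · have h2 : (g * w)⁻¹ * h * (g * w) ∈ H := H.mul_mem (H.mul_mem (H.inv_mem hg) hh) hg
    have h3 := hH.conj _ h2
    have h4 : w * ((g * w)⁻¹ * h * (g * w)) * w = g⁻¹ * h * g := by
      rw [_root_.mul_inv_rev, hH.w_inv]
      simp only [← mul_assoc, hH.w_mul_w, one_mul]
      simp only [mul_assoc, hH.w_mul_w, mul_one]
    rw [← h4, h3]
    exact H.inv_mem h2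

lemma w_mem_normalizer : w ∈ Subgroup.normalizer (H : Set G) := by
  rw [Subgroup.mem_normalizer_iff]
  intro h
  rw [hH.w_inv]
  refine ⟨fun hh => hH.conj h hh ▸ H.inv_mem hh, fun hh => ?_⟩
  have := hH.conj _ hh
  have h4 : w * (w * h * w) * w = h := by
    simp only [← mul_assoc, hH.w_mul_w, one_mul]
    simp only [mul_assoc, hH.w_mul_w, mul_one]
  rw [← h4, this]
  exact H.inv_mem hh

/-- `fusion` speaks only about nontrivial elements of `H`. For trivial `H` the normalizer is all of
`G`; this happens for S when q = 2. -/
lemma mem_normalizer_iff [Nontrivial H] (g : G) :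
    g ∈ Subgroup.normalizer (H : Set G) ↔ g ∈ H ∨ g * w ∈ H := by
  constructor
  · intro hg
    obtain ⟨⟨h, hh⟩, h1⟩ := exists_ne (1 : H)
    refine hH.fusion h hh (fun h0 => h1 (Subtype.ext h0)) g ?_
    have := (Subgroup.mem_normalizer_iff.1 (Subgroup.inv_mem _ hg) h).1 hh
    simpa using this
  · rintro (hg | hg)
    · exact Subgroup.le_normalizer hg
    · have := Subgroup.mul_mem _ (Subgroup.le_normalizer hg) hH.w_mem_normalizer
      rwa [mul_assoc, hH.w_mul_w, mul_one] at this

lemma card_conj_mem [Finite G] {h : G} (hh : h ∈ H) (h1 : h ≠ 1) :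
    Nat.card {g : G // g⁻¹ * h * g ∈ H} = 2 * Nat.card H := by
  have h2 : {g : G | g⁻¹ * h * g ∈ H} = (H : Set G) ∪ (fun g => g * w) '' (H : Set G) := by
    ext g
    simp only [Set.mem_ofPred_eq, Set.mem_union, hH.conj_mem_iff hh h1, SetLike.mem_coe,
      Set.mem_image]
    refine or_congr Iff.rfl ⟨fun hg => ⟨_, hg, by rw [mul_assoc, hH.w_mul_w, mul_one]⟩, ?_⟩
    rintro ⟨x, hx, rfl⟩
    rwa [mul_assoc, hH.w_mul_w, mul_one]
  have h3 : Disjoint (H : Set G) ((fun g => g * w) '' (H : Set G)) := by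
    rw [Set.disjoint_left]
    rintro _ hg ⟨x, hx, rfl⟩
    exact hH.w_notMem ((H.mul_mem_cancel_left hx).1 hg)
  change Nat.card {g : G | g⁻¹ * h * g ∈ H} = _
  rw [h2, Nat.card_coe_set_eq, Set.ncard_union_eq h3, Set.ncard_image_of_injective _
    (mul_left_injective w), ← Nat.card_coe_set_eq, two_mul]
  rfl

/-- The normalizer of a nontrivial dihedral torus is the union of two cosets. -/
lemma sum_normalizer [Nontrivial H] [Fintype H] [Fintype (Subgroup.normalizer (H : Set G))]
    (f : G → ℂ) :
    ∑ n : Subgroup.normalizer (H : Set G), f n = ∑ h : H, f h + ∑ h : H, f (h * w) := by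
  let φ : H ⊕ H → Subgroup.normalizer (H : Set G) := Sum.elim
    (fun h => ⟨h, Subgroup.le_normalizer h.2⟩)
    (fun h => ⟨h * w, Subgroup.mul_mem _ (Subgroup.le_normalizer h.2) hH.w_mem_normalizer⟩)
  have hφ : Function.Bijective φ := by
    constructor
    · rintro (x | x) (y | y) hxy
      · have : (x : G) = y :=
          congr_arg (fun z : Subgroup.normalizer (H : Set G) => (z : G)) hxy
        exact congr_arg Sum.inl (Subtype.ext this)
      · have : (x : G) = y * w := congr_arg Subtype.val hxy
        exact absurd ((H.mul_mem_cancel_left y.2).1 (this ▸ x.2)) hH.w_notMem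
      · have : (x : G) * w = y := congr_arg Subtype.val hxy
        exact absurd ((H.mul_mem_cancel_left x.2).1 (this ▸ y.2)) hH.w_notMem
      · have : (x : G) * w = y * w := congr_arg Subtype.val hxy
        exact congr_arg Sum.inr (Subtype.ext (mul_right_cancel this))
    · rintro ⟨n, hn⟩
      rcases (hH.mem_normalizer_iff n).1 hn with h | h
      · exact ⟨Sum.inl ⟨n, h⟩, rfl⟩
      · exact ⟨Sum.inr ⟨_, h⟩, Subtype.ext (by simp [φ, mul_assoc, hH.w_mul_w])⟩
  rw [← Equiv.sum_comp (Equiv.ofBijective φ hφ), Fintype.sum_sum_type]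
  rfl

lemma card_normalizer [Nontrivial H] [Finite H] :
    Nat.card (Subgroup.normalizer (H : Set G)) = 2 * Nat.card H := by
  classical
  have := Fintype.ofFinite H
  have : Finite (Subgroup.normalizer (H : Set G)) := by
    have : (Subgroup.normalizer (H : Set G) : Set G) ⊆
        (H : Set G) ∪ (fun g => g * w) '' (H : Set G) := by
      intro g hg
      rcases (hH.mem_normalizer_iff g).1 hg with h | h
      · exact Or.inl h
      · exact Or.inr ⟨_, h, by simp [mul_assoc, hH.w_mul_w]⟩
    exact ((Set.toFinite (H : Set G)).union ((Set.toFinite (H : Set G)).image _)).subset this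
  have := Fintype.ofFinite (Subgroup.normalizer (H : Set G))
  have h := hH.sum_normalizer fun _ => 1
  simp only [Finset.sum_const, Finset.card_univ, nsmul_eq_mul, mul_one,
    ← Nat.card_eq_fintype_card] at h
  rw [two_mul]
  exact_mod_cast h

/-- For n in the nontrivial coset, h n h⁻¹ = h² n. Averaging over h replaces σ(n) by its product
with the projector onto the invariants of h ↦ σ(h²), without changing the trace; the hypothesis says
that this projector is zero. -/
lemma character_mul_w_eq_zero [Fintype H] {W : Type*} [AddCommGroup W] [Module ℂ W]
    [FiniteDimensional ℂ W] (σ : Representation ℂ (Subgroup.normalizer (H : Set G)) W)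
    (hσ : ∑ h : H, (resNormalizer σ).character (h * h) = 0) (n : Subgroup.normalizer (H : Set G))
    (hn : (n : G) * w ∈ H) : σ.character n = 0 := by
  let ι : H →* Subgroup.normalizer (H : Set G) := Subgroup.inclusion Subgroup.le_normalizer
  let sq : H →* H :=
    { toFun := fun h => h * h
      map_one' := by simp
      map_mul' := fun a b => Subtype.ext <| by
        have := hH.comm a a.2 b b.2
        simp only [Subgroup.coe_mul]
        rw [mul_assoc, ← mul_assoc (b : G), ← this]
        simp only [mul_assoc] }
  let σ₂ : Representation ℂ H W := σ.comp (ι.comp sq)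
  have hinv : σ₂.invariants = ⊥ := by
    have h1 := average_character σ₂
    have h2 : ∑ h : H, σ₂.character h = 0 := hσ
    rw [h2, mul_zero] at h1
    exact Submodule.finrank_eq_zero.1 (by exact_mod_cast h1.symm)
  have hsum : ∑ h : H, σ₂ h = 0 := by
    ext v
    have : (∑ h : H, σ₂ h) v ∈ σ₂.invariants := by
      rw [mem_invariants]
      intro g
      rw [LinearMap.sum_apply, map_sum, ← _root_.Equiv.sum_comp (Equiv.mulLeft g) fun h => σ₂ h v]
      exact Finset.sum_congr rfl fun h _ => by
        rw [Equiv.coe_mulLeft, map_mul]; rfl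
    rw [hinv, Submodule.mem_bot] at this
    simpa using this
  -- Moving h⁻¹ to the left past `w` inverts it, which turns conjugation into multiplication by h².
  have hconj : ∀ h : H, ι (sq h) * n = ι h * n * (ι h)⁻¹ := by
    intro h
    refine Subtype.ext ?_
    change (h : G) * h * n = h * n * (h : G)⁻¹
    have h1 : (n : G) = ((n : G) * w) * w := by rw [mul_assoc, hH.w_mul_w, mul_one]
    have h2 : w * (h : G)⁻¹ = h * w := by
      rw [← hH.conj h h.2, ← mul_assoc, ← mul_assoc, hH.w_mul_w, one_mul]
    have h3 := hH.comm _ hn h h.2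
    calc (h : G) * h * n = h * (h * (n * w)) * w := by
          simp only [mul_assoc, hH.w_mul_w, mul_one]
      _ = h * n * (w * (h * w)) := by rw [← h3]; simp only [mul_assoc]
      _ = h * n * (h : G)⁻¹ := by rw [← h2, ← mul_assoc w, hH.w_mul_w, one_mul]
  have h4 : (Nat.card H : ℂ) * σ.character n = LinearMap.trace ℂ W ((∑ h : H, σ₂ h) * σ n) := by
    rw [Finset.sum_mul, map_sum, Nat.card_eq_fintype_card, ← nsmul_eq_mul, ← Finset.card_univ,
      ← Finset.sum_const]
    refine Finset.sum_congr rfl fun h _ => ?_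
    rw [← char_conj σ n (ι h), ← hconj, character, map_mul]
    rfl
  rw [hsum, zero_mul, map_zero] at h4
  exact (mul_eq_zero.1 h4).resolve_left (NeZero.ne _)

end IsDihedralTorus

/-! ### Inducing a character of the torus to its normalizer. -/

section DihedralRep

variable {G : Type*} [Group G] {H : Subgroup G} {w : G}

open scoped Classical in
/-- Extension of a character of a subgroup by zero. -/
def extendZero (χ : H →* ℂˣ) (g : G) : ℂ := if h : g ∈ H then χ ⟨g, h⟩ else 0

lemma extendZero_coe (χ : H →* ℂˣ) (h : H) : extendZero χ h = χ h := by
  simp [extendZero]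

lemma extendZero_of_notMem (χ : H →* ℂˣ) {g : G} (hg : g ∉ H) : extendZero χ g = 0 := by
  simp [extendZero, hg]

lemma extendZero_mul (χ : H →* ℂˣ) {x : G} (hx : x ∈ H) (y : G) :
    extendZero χ (x * y) = extendZero χ x * extendZero χ y := by
  by_cases hy : y ∈ H
  · lift x to H using hx
    lift y to H using hy
    rw [← Subgroup.coe_mul, extendZero_coe, extendZero_coe, extendZero_coe, map_mul, Units.val_mul]
  · rw [extendZero_of_notMem χ hy, extendZero_of_notMem χ (fun h => hy
      ((H.mul_mem_cancel_left hx).1 h)), mul_zero]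

/-- A character of a nontrivial dihedral torus, induced to the normalizer. -/
lemma IsDihedralTorus.exists_induced (hH : IsDihedralTorus H w) [Nontrivial H] (χ : H →* ℂˣ) :
    ∃ σ : Representation ℂ (Subgroup.normalizer (H : Set G)) (Fin 2 → ℂ),
      ∀ h : H, (resNormalizer σ).character h = χ h + χ h⁻¹ := by
  -- Exactly one of x and xw lies in `H`, so one summand vanishes. This is matrix multiplication for
  -- the induced representation in the basis indexed by the cosets of 1 and w.
  have key : ∀ x y : G, (x ∈ H ∨ x * w ∈ H) → extendZero χ (x * y) =
      extendZero χ x * extendZero χ y + extendZero χ (x * w) * extendZero χ (w * y) := by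
    rintro x y (hx | hx)
    · rw [extendZero_mul χ hx, extendZero_of_notMem χ (g := x * w), zero_mul, add_zero]
      exact fun h => hH.w_notMem ((H.mul_mem_cancel_left hx).1 h)
    · have : x * y = (x * w) * (w * y) := by
        rw [mul_assoc, ← mul_assoc w, hH.w_mul_w, one_mul]
      rw [this, extendZero_mul χ hx, extendZero_of_notMem χ (hH.notMem_of_mul_mem hx), zero_mul,
        zero_add]
  have hw : ∀ x : G, w * (w * x) = x := fun x => by rw [← mul_assoc, hH.w_mul_w, one_mul]
  let M : Subgroup.normalizer (H : Set G) →* Matrix (Fin 2) (Fin 2) ℂ :=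
    { toFun := fun n => !![extendZero χ n, extendZero χ (n * w);
        extendZero χ (w * n), extendZero χ (w * n * w)]
      map_one' := by
        have h1 : extendZero χ (1 : G) = 1 := by
          have := extendZero_coe χ 1
          simpa using this
        simp [hH.w_mul_w, h1, extendZero_of_notMem χ hH.w_notMem, Matrix.one_fin_two]
      map_mul' := fun n m => by
        have h1 := (hH.mem_normalizer_iff n).1 n.2
        have h2 := (hH.mem_normalizer_iff (w * n)).1
          (Subgroup.mul_mem _ hH.w_mem_normalizer n.2)
        rw [Matrix.mul_fin_two, ← key _ _ h1, ← key _ _ h2, mul_assoc w (m : G), ← key _ _ h1,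
          ← key _ _ h2]
        simp only [Subgroup.coe_mul, mul_assoc] }
  refine ⟨(Matrix.toLinAlgEquiv' (R := ℂ) (n := Fin 2)).toAlgHom.toMonoidHom.comp M, fun h => ?_⟩
  have : (resNormalizer ((Matrix.toLinAlgEquiv' (R := ℂ) (n := Fin 2)).toAlgHom.toMonoidHom.comp M)
      : Representation ℂ H (Fin 2 → ℂ)) h = Matrix.toLin' (M ⟨h, Subgroup.le_normalizer h.2⟩) := rfl
  rw [character, this, Matrix.trace_toLin'_eq, Matrix.trace_fin_two]
  change extendZero χ h + extendZero χ (w * h * w) = _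
  rw [hH.conj h h.2, extendZero_coe, ← Subgroup.coe_inv, extendZero_coe]

end DihedralRep

/-! ### Summing a class function over the conjugates of a subgroup. -/

section ConjugateCount

variable {G : Type*} [Group G] [Fintype G]

open scoped Classical in
/-- Sum of a class function over the nontrivial elements conjugate into a subgroup `H` such that
all nontrivial `h ∈ H` are moved into `H` by the same number of elements of `G`. -/
lemma sum_conj_mem (H : Subgroup G) [Fintype H] (N : ℕ)
    (hN : ∀ h ∈ H, h ≠ 1 → Nat.card {g : G // g⁻¹ * h * g ∈ H} = N) (f : G → ℂ)
    (hf : ∀ g h, f (h * g * h⁻¹) = f g) :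
    (N : ℂ) * ∑ x with x ≠ 1 ∧ ∃ g : G, g⁻¹ * x * g ∈ H, f x =
      Nat.card G * (∑ h : H, f h - f 1) := by
  -- Double counting of the pairs (x, g) with x ≠ 1 and g⁻¹xg in `H`, weighted by f(x): a fixed x
  -- admits N elements g or none, while a fixed g gives the sum of f over the nontrivial elements of
  -- `H`.
  have h1 : ∀ x, (if x ≠ 1 ∧ ∃ g : G, g⁻¹ * x * g ∈ H then (N : ℂ) * f x else 0)
      = ∑ g : G, if x ≠ 1 ∧ g⁻¹ * x * g ∈ H then f x else 0 := by
    intro x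
    split_ifs with hx
    · obtain ⟨hx1, g₀, hg₀⟩ := hx
      have h2 := hN _ hg₀ (fun h => hx1 (by
        have : x = g₀ * (g₀⁻¹ * x * g₀) * g₀⁻¹ := by group
        rw [this, h]; simp))
      have h3 : Nat.card {g : G // g⁻¹ * (g₀⁻¹ * x * g₀) * g ∈ H} =
          Nat.card {g : G // g⁻¹ * x * g ∈ H} := by
        refine Nat.card_congr ((Equiv.mulLeft g₀).subtypeEquiv fun g => ?_)
        simp [mul_assoc]
      rw [← Finset.sum_filter, Finset.sum_const, nsmul_eq_mul, ← h2, h3, Nat.card_eq_fintype_card,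
        Fintype.card_subtype]
      simp [hx1]
    · symm
      refine Finset.sum_eq_zero fun g _ => if_neg fun h => hx ⟨h.1, g, h.2⟩
  rw [Finset.mul_sum, Finset.sum_filter]
  simp_rw [h1]
  rw [Finset.sum_comm]
  have h4 : ∀ g : G, (∑ x, if x ≠ 1 ∧ g⁻¹ * x * g ∈ H then f x else 0) = ∑ h : H, f h - f 1 := by
    intro g
    rw [← (MulAut.conj g).toEquiv.sum_comp]
    have : ∀ x, (if (MulAut.conj g).toEquiv x ≠ 1 ∧ g⁻¹ * (MulAut.conj g).toEquiv x * g ∈ H then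
        f ((MulAut.conj g).toEquiv x) else 0) =
        (if x ∈ H then f x else 0) - if x = 1 then f 1 else 0 := by
      intro x
      have e1 : (MulAut.conj g).toEquiv x = g * x * g⁻¹ := rfl
      have e2 : g⁻¹ * (g * x * g⁻¹) * g = x := by group
      rw [e1, hf, e2]
      by_cases hx : x = 1
      · subst hx; simp [H.one_mem]
      · have : g * x * g⁻¹ ≠ 1 := by simpa [mul_inv_eq_one] using hx
        simp [hx]
    rw [Finset.sum_congr rfl fun x _ => this x, Finset.sum_sub_distrib, ← Finset.sum_filter,
      Finset.sum_ite_eq' Finset.univ 1, if_pos (Finset.mem_univ _)]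
    congr 1
    exact Finset.sum_subtype _ (by simp) _
  rw [Finset.sum_congr rfl fun g _ => h4 g, Finset.sum_const, Finset.card_univ, nsmul_eq_mul,
    Nat.card_eq_fintype_card]

end ConjugateCount

/-! ### Subgroups of PGL₂ in terms of matrix entries. -/

section Membership

variable {F : Type*} [Field F]

lemma coe_mul_scalar (g : GL (Fin 2) F) (u : Fˣ) :
    ((g * GeneralLinearGroup.scalar (Fin 2) u : GL (Fin 2) F) : Matrix (Fin 2) (Fin 2) F) =
      (u : F) • (g : Matrix (Fin 2) (Fin 2) F) := by
  ext i j
  simp [Matrix.smul_apply, mul_comm]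

lemma coe_inv_eq (g : GL (Fin 2) F) :
    ((g⁻¹ : GL (Fin 2) F) : Matrix (Fin 2) (Fin 2) F) =
      (g : Matrix (Fin 2) (Fin 2) F).det⁻¹ •
        ((g : Matrix (Fin 2) (Fin 2) F).trace • 1 - (g : Matrix (Fin 2) (Fin 2) F)) := by
  rw [Matrix.coe_units_inv, Matrix.inv_def, Ring.inverse_eq_inv']
  congr 1
  ext i j
  fin_cases i <;> fin_cases j <;> simp [Matrix.adjugate_fin_two, Matrix.trace_fin_two]

/-- The choice of representative is harmless because `K` contains the scalars, and Cayley–Hamilton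
in the form `coe_inv_eq` puts the inverse in `K`. -/
lemma mk_mem_unitsImage {K : Subalgebra F (Matrix (Fin 2) (Fin 2) F)} {g : GL (Fin 2) F} :
    ProjGenLinGroup.mk g ∈ unitsImage K ↔ (g : Matrix (Fin 2) (Fin 2) F) ∈ K := by
  constructor
  · rintro ⟨h, hh, hg⟩
    obtain ⟨u, rfl⟩ := ProjGenLinGroup.mk_eq_mk_iff.1 hg
    rw [coe_mul_scalar]
    exact K.smul_mem (Submonoid.mem_units_iff _ _ |>.1 hh).1 _
  · intro hg
    refine ⟨g, (Submonoid.mem_units_iff _ _).2 ⟨hg, ?_⟩, rfl⟩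
    change ((g⁻¹ : GL (Fin 2) F) : Matrix (Fin 2) (Fin 2) F) ∈ K
    rw [coe_inv_eq]
    exact K.smul_mem (K.sub_mem (K.smul_mem K.one_mem _) hg) _

lemma mk_mem_splitTorus {g : GL (Fin 2) F} :
    ProjGenLinGroup.mk g ∈ splitTorus F ↔ g 0 1 = 0 ∧ g 1 0 = 0 := by
  rw [splitTorus, mk_mem_unitsImage, AlgHom.mem_range]
  constructor
  · rintro ⟨d, hd⟩
    simp [← hd]
  · rintro ⟨h1, h2⟩
    refine ⟨![g 0 0, g 1 1], ?_⟩
    ext i j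
    fin_cases i <;> fin_cases j <;> simp [h1, h2]

lemma mk_mem_borel {g : GL (Fin 2) F} : ProjGenLinGroup.mk g ∈ borel F ↔ g 1 0 = 0 := by
  constructor
  · rintro ⟨h, hh, hg⟩
    obtain ⟨u, rfl⟩ := ProjGenLinGroup.mk_eq_mk_iff.1 hg
    change (h : Matrix (Fin 2) (Fin 2) F) 1 0 = 0 at hh
    rw [coe_mul_scalar, Matrix.smul_apply, hh, smul_zero]
  · exact fun hg => ⟨g, hg, rfl⟩

lemma mk_eq_one_iff {g : GL (Fin 2) F} :
    ProjGenLinGroup.mk g = 1 ↔ g 0 1 = 0 ∧ g 1 0 = 0 ∧ g 0 0 = g 1 1 := by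
  rw [← ProjGenLinGroup.mk_one, eq_comm, ProjGenLinGroup.mk_eq_mk_iff]
  constructor
  · rintro ⟨u, rfl⟩
    simp
  · rintro ⟨h1, h2, h3⟩
    have hdet := g.det_ne_zero
    rw [Matrix.det_fin_two, h1, h2, ← h3] at hdet
    refine ⟨Units.mk0 (g 0 0) fun h => hdet (by simp [h]), ?_⟩
    ext i j
    rw [coe_mul_scalar]
    fin_cases i <;> fin_cases j <;> simp [h1, h2, h3]

variable (F) in
/-- The subgroup `U` of the classes of the unipotent upper triangular matrices. -/
def unipotentGroup : Subgroup PGL(2, F) where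
  carrier := Set.range unip
  one_mem' := ⟨0, by simp [unip]⟩
  mul_mem' := by
    rintro _ _ ⟨x, rfl⟩ ⟨y, rfl⟩
    exact ⟨x + y, by simp only [unip, AddChar.map_add_eq_mul, map_mul]⟩
  inv_mem' := by
    rintro _ ⟨x, rfl⟩
    exact ⟨-x, by simp only [unip, AddChar.map_neg_eq_inv, map_inv]⟩

lemma unip_add (x y : F) : unip (x + y) = unip x * unip y := by
  simp only [unip, AddChar.map_add_eq_mul, map_mul]

lemma unip_zero : unip (0 : F) = 1 := by simp [unip]

lemma mk_mem_unipotentGroup {g : GL (Fin 2) F} :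
    ProjGenLinGroup.mk g ∈ unipotentGroup F ↔ g 1 0 = 0 ∧ g 0 0 = g 1 1 := by
  constructor
  · rintro ⟨x, hx⟩
    obtain ⟨u, rfl⟩ := ProjGenLinGroup.mk_eq_mk_iff.1 hx
    rw [coe_mul_scalar]
    simp
  · rintro ⟨h1, h2⟩
    have hdet := g.det_ne_zero
    rw [Matrix.det_fin_two, h1, ← h2] at hdet
    have h0 : g 0 0 ≠ 0 := fun h => hdet (by simp [h])
    refine ⟨g 0 1 / g 0 0, ProjGenLinGroup.mk_eq_mk_iff.2 ⟨Units.mk0 _ h0, ?_⟩⟩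
    ext i j
    rw [coe_mul_scalar]
    fin_cases i <;> fin_cases j <;> simp [h1, h2, mul_div_cancel₀ _ (h2 ▸ h0)]

lemma unip_injective : Function.Injective (unip : F → PGL(2, F)) := by
  intro x y hxy
  obtain ⟨u, hu⟩ := ProjGenLinGroup.mk_eq_mk_iff.1 hxy
  have h : (u : F) • ((GeneralLinearGroup.upperRightHom x : GL (Fin 2) F) :
      Matrix (Fin 2) (Fin 2) F) = (GeneralLinearGroup.upperRightHom y : GL (Fin 2) F) := by
    rw [← hu, coe_mul_scalar]
  have h0 := congr_fun₂ h 0 0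
  have h1 := congr_fun₂ h 0 1
  simp at h0 h1
  simpa [h0] using h1

lemma conj_entries (g h : GL (Fin 2) F) :
    (g : Matrix (Fin 2) (Fin 2) F) * ((g⁻¹ * h * g : GL (Fin 2) F) : Matrix (Fin 2) (Fin 2) F) =
      (h : Matrix (Fin 2) (Fin 2) F) * g := by
  rw [← Units.val_mul, ← Units.val_mul]
  congr 1
  group

lemma det_conj (g h : GL (Fin 2) F) :
    ((g⁻¹ * h * g : GL (Fin 2) F) : Matrix (Fin 2) (Fin 2) F).det =
      (h : Matrix (Fin 2) (Fin 2) F).det := by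
  rw [Units.val_mul, Units.val_mul, Matrix.det_units_conj']

lemma trace_conj (g h : GL (Fin 2) F) :
    ((g⁻¹ * h * g : GL (Fin 2) F) : Matrix (Fin 2) (Fin 2) F).trace =
      (h : Matrix (Fin 2) (Fin 2) F).trace := by
  rw [Units.val_mul, Units.val_mul, Matrix.trace_units_conj']

end Membership

/-! ### The split torus. -/

section SplitTorus

variable {F : Type*} [Field F]

variable (F) in
/-- The Weyl element of the split torus. -/
def weyl : PGL(2, F) :=
  ProjGenLinGroup.mk (GeneralLinearGroup.mkOfDetNeZero !![0, 1; 1, 0] (by simp))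

/-- The class of the diagonal matrix with entries `a` and `1`. -/
def diagElt (a : Fˣ) : PGL(2, F) :=
  ProjGenLinGroup.mk (GeneralLinearGroup.mkOfDetNeZero !![(a : F), 0; 0, 1] (by simp))

lemma diagElt_mem (a : Fˣ) : diagElt a ∈ splitTorus F := by
  rw [diagElt, mk_mem_splitTorus]
  simp [GeneralLinearGroup.mkOfDetNeZero]

lemma diagElt_mul (a b : Fˣ) : diagElt (a * b) = diagElt a * diagElt b := by
  simp only [diagElt, ← map_mul]
  congr 1
  ext i j
  fin_cases i <;> fin_cases j <;> simp [GeneralLinearGroup.mkOfDetNeZero]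

variable (F) in
/-- The isomorphism of `Fˣ` with the split torus. -/
def diagHom : Fˣ →* splitTorus F :=
  MonoidHom.mk' (fun a => ⟨diagElt a, diagElt_mem a⟩) fun a b => Subtype.ext (diagElt_mul a b)

lemma diagHom_bijective : Function.Bijective (diagHom F) := by
  constructor
  · intro a b hab
    have h := congr_arg Subtype.val hab
    obtain ⟨u, hu⟩ := ProjGenLinGroup.mk_eq_mk_iff.1 h
    have h : (u : F) • !![(a : F), 0; 0, 1] = !![(b : F), 0; 0, 1] := by
      have := congr_arg (fun g : GL (Fin 2) F => (g : Matrix (Fin 2) (Fin 2) F)) hu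
      rwa [coe_mul_scalar] at this
    have h0 := congr_fun₂ h 0 0
    have h1 := congr_fun₂ h 1 1
    simp at h0 h1
    ext
    simpa [h1] using h0
  · rintro ⟨s, hs⟩
    induction s using ProjGenLinGroup.induction_on with
    | mk g =>
      have h := mk_mem_splitTorus.1 hs
      have hdet := g.det_ne_zero
      rw [Matrix.det_fin_two, h.1, zero_mul, sub_zero] at hdet
      have h0 := left_ne_zero_of_mul hdet
      have h1 := right_ne_zero_of_mul hdet
      refine ⟨Units.mk0 _ h0 / Units.mk0 _ h1, Subtype.ext ?_⟩
      refine ProjGenLinGroup.mk_eq_mk_iff.2 ⟨Units.mk0 _ h1, ?_⟩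
      ext i j
      rw [coe_mul_scalar]
      fin_cases i <;> fin_cases j <;> simp [h.1, h.2, GeneralLinearGroup.mkOfDetNeZero, h1,
        mul_div_cancel₀]

lemma card_splitTorus [Finite F] : Nat.card (splitTorus F) = Nat.card F - 1 := by
  rw [← Nat.card_congr (Equiv.ofBijective _ (diagHom_bijective (F := F))), Nat.card_units]

lemma coe_weyl_mul (g : GL (Fin 2) F) :
    ProjGenLinGroup.mk g * weyl F = ProjGenLinGroup.mk
      (g * (GeneralLinearGroup.mkOfDetNeZero !![0, 1; 1, 0] (by simp))) := by
  rw [map_mul]; rfl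

lemma isDihedralTorus_splitTorus : IsDihedralTorus (splitTorus F) (weyl F) where
  comm a ha b hb := by
    obtain ⟨x, hx⟩ := diagHom_bijective.2 ⟨a, ha⟩
    obtain ⟨y, hy⟩ := diagHom_bijective.2 ⟨b, hb⟩
    have : (⟨a, ha⟩ * ⟨b, hb⟩ : splitTorus F) = ⟨b, hb⟩ * ⟨a, ha⟩ := by
      rw [← hx, ← hy, ← map_mul, ← map_mul, mul_comm]
    exact congr_arg Subtype.val this
  w_mul_w := by
    rw [weyl, ← map_mul, mk_eq_one_iff]
    simp [GeneralLinearGroup.mkOfDetNeZero]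
  w_notMem := by
    rw [weyl, mk_mem_splitTorus]
    simp [GeneralLinearGroup.mkOfDetNeZero]
  conj h hh := by
    induction h using ProjGenLinGroup.induction_on with
    | mk g =>
      have h := mk_mem_splitTorus.1 hh
      rw [eq_inv_iff_mul_eq_one, weyl, ← map_mul, ← map_mul, ← map_mul, mk_eq_one_iff]
      have hg : (g : Matrix (Fin 2) (Fin 2) F) = !![g 0 0, 0; 0, g 1 1] := by
        ext i j
        fin_cases i <;> fin_cases j <;> simp [h]
      simp only [Units.val_mul]
      rw [hg]
      simp [GeneralLinearGroup.mkOfDetNeZero, mul_comm]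
  fusion h hh h1 g hg := by
    induction h using ProjGenLinGroup.induction_on with
    | mk h =>
    induction g using ProjGenLinGroup.induction_on with
    | mk g =>
      have h2 := mk_mem_splitTorus.1 hh
      rw [← map_inv, ← map_mul, ← map_mul] at hg
      have h3 := mk_mem_splitTorus.1 hg
      have h4 : h 0 0 ≠ h 1 1 := fun h0 => h1 (mk_eq_one_iff.2 ⟨h2.1, h2.2, h0⟩)
      rw [coe_weyl_mul, mk_mem_splitTorus, mk_mem_splitTorus]
      have h5 := conj_entries g h
      have e00 := congr_fun₂ h5 0 0
      have e01 := congr_fun₂ h5 0 1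
      have e10 := congr_fun₂ h5 1 0
      have e11 := congr_fun₂ h5 1 1
      have hdet := g.det_ne_zero
      rw [Matrix.det_fin_two] at hdet
      rw [Matrix.mul_apply, Matrix.mul_apply, Fin.sum_univ_two, Fin.sum_univ_two] at e00 e01 e10 e11
      rw [h3.1] at e01 e11
      rw [h3.2] at e00 e10
      rw [h2.1] at e00 e01
      rw [h2.2] at e10 e11
      simp [GeneralLinearGroup.mkOfDetNeZero, Matrix.mul_apply, Fin.sum_univ_two]
      grind

end SplitTorus

/-! ### Unipotent elements, the Borel subgroup and group orders. -/

section Unipotent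

variable {F : Type*} [Field F]

lemma unip_conj_mem_iff {h : PGL(2, F)} (hh : h ∈ unipotentGroup F) (h1 : h ≠ 1) (g : PGL(2, F)) :
    g⁻¹ * h * g ∈ unipotentGroup F ↔ g ∈ borel F := by
  induction h using ProjGenLinGroup.induction_on with
  | mk h =>
  induction g using ProjGenLinGroup.induction_on with
  | mk g =>
    have h2 := mk_mem_unipotentGroup.1 hh
    have h4 : h 0 1 ≠ 0 := fun h0 => h1 (mk_eq_one_iff.2 ⟨h0, h2⟩)
    rw [← map_inv, ← map_mul, ← map_mul, mk_mem_unipotentGroup, mk_mem_borel]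
    have h5 := conj_entries g h
    generalize ((g⁻¹ * h * g : GL (Fin 2) F) : Matrix (Fin 2) (Fin 2) F) = M at h5 ⊢
    have e00 := congr_fun₂ h5 0 0
    have e01 := congr_fun₂ h5 0 1
    have e10 := congr_fun₂ h5 1 0
    have e11 := congr_fun₂ h5 1 1
    have hdet := g.det_ne_zero
    rw [Matrix.det_fin_two] at hdet
    rw [Matrix.mul_apply, Matrix.mul_apply, Fin.sum_univ_two, Fin.sum_univ_two] at e00 e01 e10 e11
    grind

/-- A nontrivial element of U fixes only the line spanned by the first basis vector, so g must
preserve that line. -/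
lemma borel_conj_mem_iff_of_unipotent {h : PGL(2, F)} (hh : h ∈ unipotentGroup F) (h1 : h ≠ 1)
    (g : PGL(2, F)) : g⁻¹ * h * g ∈ borel F ↔ g ∈ borel F := by
  induction h using ProjGenLinGroup.induction_on with
  | mk h =>
  induction g using ProjGenLinGroup.induction_on with
  | mk g =>
    have h2 := mk_mem_unipotentGroup.1 hh
    have h4 : h 0 1 ≠ 0 := fun h0 => h1 (mk_eq_one_iff.2 ⟨h0, h2⟩)
    rw [← map_inv, ← map_mul, ← map_mul, mk_mem_borel, mk_mem_borel]
    have h5 := conj_entries g h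
    generalize ((g⁻¹ * h * g : GL (Fin 2) F) : Matrix (Fin 2) (Fin 2) F) = M at h5 ⊢
    have e00 := congr_fun₂ h5 0 0
    have e01 := congr_fun₂ h5 0 1
    have e10 := congr_fun₂ h5 1 0
    have e11 := congr_fun₂ h5 1 1
    have hdet := g.det_ne_zero
    rw [Matrix.det_fin_two] at hdet
    rw [Matrix.mul_apply, Matrix.mul_apply, Fin.sum_univ_two, Fin.sum_univ_two] at e00 e01 e10 e11
    grind

/-- A nontrivial diagonal class fixes exactly the two coordinate lines, which the Weyl element
exchanges. -/
lemma borel_conj_mem_iff_of_split {h : PGL(2, F)} (hh : h ∈ splitTorus F) (h1 : h ≠ 1)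
    (g : PGL(2, F)) : g⁻¹ * h * g ∈ borel F ↔ g ∈ borel F ∨ weyl F * g ∈ borel F := by
  induction h using ProjGenLinGroup.induction_on with
  | mk h =>
  induction g using ProjGenLinGroup.induction_on with
  | mk g =>
    have h2 := mk_mem_splitTorus.1 hh
    have h4 : h 0 0 ≠ h 1 1 := fun h0 => h1 (mk_eq_one_iff.2 ⟨h2.1, h2.2, h0⟩)
    rw [weyl, ← map_mul, ← map_inv, ← map_mul, ← map_mul, mk_mem_borel, mk_mem_borel, mk_mem_borel]
    have h5 := conj_entries g h
    generalize ((g⁻¹ * h * g : GL (Fin 2) F) : Matrix (Fin 2) (Fin 2) F) = M at h5 ⊢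
    have e00 := congr_fun₂ h5 0 0
    have e01 := congr_fun₂ h5 0 1
    have e10 := congr_fun₂ h5 1 0
    have e11 := congr_fun₂ h5 1 1
    have hdet := g.det_ne_zero
    rw [Matrix.det_fin_two] at hdet
    rw [Matrix.mul_apply, Matrix.mul_apply, Fin.sum_univ_two, Fin.sum_univ_two] at e00 e01 e10 e11
    simp [GeneralLinearGroup.mkOfDetNeZero, Matrix.mul_apply, Fin.sum_univ_two]
    grind

lemma diagElt_conj_unip (a : Fˣ) (x : F) :
    diagElt a * unip x * (diagElt a)⁻¹ = unip (a * x) := by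
  rw [mul_inv_eq_iff_eq_mul]
  simp only [diagElt, unip, ← map_mul]
  congr 1
  ext i j
  fin_cases i <;> fin_cases j <;> simp [GeneralLinearGroup.mkOfDetNeZero]

lemma card_borel [Finite F] : Nat.card (borel F) = Nat.card F * (Nat.card F - 1) := by
  have hm : ∀ (x : F) (a : Fˣ), unip x * diagElt a ∈ borel F := by
    intro x a
    rw [unip, diagElt, ← map_mul, mk_mem_borel]
    simp [GeneralLinearGroup.mkOfDetNeZero, Matrix.mul_apply, Fin.sum_univ_two]
  rw [← Nat.card_units, ← Nat.card_prod]
  refine (Nat.card_congr (Equiv.ofBijective (fun p : F × Fˣ => ⟨unip p.1 * diagElt p.2, hm _ _⟩)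
    ⟨?_, ?_⟩)).symm
  · rintro ⟨x, a⟩ ⟨y, b⟩ h
    have h : unip x * diagElt a = unip y * diagElt b := congr_arg Subtype.val h
    simp only [diagElt, unip, ← map_mul] at h
    obtain ⟨u, hu⟩ := ProjGenLinGroup.mk_eq_mk_iff.1 h
    have h := congr_arg (fun g : GL (Fin 2) F => (g : Matrix (Fin 2) (Fin 2) F)) hu
    simp only [coe_mul_scalar] at h
    have h00 := congr_fun₂ h 0 0
    have h01 := congr_fun₂ h 0 1
    have h11 := congr_fun₂ h 1 1
    simp [GeneralLinearGroup.mkOfDetNeZero, Matrix.mul_apply, Fin.sum_univ_two] at h00 h01 h11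
    rw [h11, Units.val_one, one_mul] at h00 h01
    exact Prod.ext h01 (Units.ext h00)
  · rintro ⟨s, hs⟩
    induction s using ProjGenLinGroup.induction_on with
    | mk g =>
      have h := mk_mem_borel.1 hs
      have hdet := g.det_ne_zero
      rw [Matrix.det_fin_two, h, mul_zero, sub_zero] at hdet
      have h0 := left_ne_zero_of_mul hdet
      have h1 := right_ne_zero_of_mul hdet
      refine ⟨⟨g 0 1 / g 1 1, Units.mk0 _ h0 / Units.mk0 _ h1⟩, Subtype.ext ?_⟩
      simp only [diagElt, unip, ← map_mul]
      refine ProjGenLinGroup.mk_eq_mk_iff.2 ⟨Units.mk0 _ h1, ?_⟩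
      ext i j
      rw [coe_mul_scalar]
      fin_cases i <;> fin_cases j <;> simp [h, GeneralLinearGroup.mkOfDetNeZero, h1,
        mul_div_cancel₀]

lemma card_PGL [Finite F] :
    (Nat.card PGL(2, F) : ℤ) = Nat.card F * ((Nat.card F : ℤ) ^ 2 - 1) := by
  have := Fintype.ofFinite F
  have h1 : Nat.card (GL (Fin 2) F) =
      Nat.card PGL(2, F) * Nat.card (Subgroup.center (GL (Fin 2) F)) :=
    Subgroup.card_eq_card_quotient_mul_card_subgroup _
  have h2 : Nat.card (Subgroup.center (GL (Fin 2) F)) = Nat.card F - 1 := by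
    rw [GeneralLinearGroup.center_eq_range_scalar, ← Nat.card_units]
    refine (Nat.card_congr (Equiv.ofInjective _ fun u v h => ?_)).symm
    have := congr_arg (fun g : GL (Fin 2) F => g 0 0) h
    ext
    simpa using this
  have h3 : 1 < Nat.card F := Finite.one_lt_card
  rw [Matrix.card_GL_field, Fin.prod_univ_two, h2, ← Nat.card_eq_fintype_card] at h1
  have h4 : (Nat.card F : ℤ) - 1 ≠ 0 := by
    have : (1 : ℤ) < Nat.card F := by exact_mod_cast h3
    omega
  apply mul_right_cancel₀ h4
  have h5 := congr_arg (fun n : ℕ => (n : ℤ)) h1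
  simp only [Nat.cast_mul] at h5
  rw [Nat.cast_sub (Nat.pow_le_pow_right h3.le (by simp)),
    Nat.cast_sub (Nat.pow_le_pow_right h3.le (by simp)), Nat.cast_sub h3.le] at h5
  push_cast at h5
  simp only [Fin.val_zero, Fin.val_one, pow_zero, pow_one] at h5
  linear_combination -h5

end Unipotent

/-! ### Quadratic subfields of the 2 × 2 matrices. -/

section QuadraticSubfield

variable {F : Type*} [Field F] {K : Subalgebra F (Matrix (Fin 2) (Fin 2) F)}

lemma eq_zero_of_det_eq_zero (hK : IsField K) {β : Matrix (Fin 2) (Fin 2) F} (hβ : β ∈ K)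
    (h : β.det = 0) : β = 0 := by
  by_contra h0
  obtain ⟨γ, hγ⟩ := hK.mul_inv_cancel (a := ⟨β, hβ⟩) fun h' => h0 (congr_arg Subtype.val h')
  have h1 : β * γ = 1 := congr_arg Subtype.val hγ
  have h2 := congr_arg Matrix.det h1
  rw [Matrix.det_mul, h, zero_mul, Matrix.det_one] at h2
  exact zero_ne_one h2

/-- An eigenvalue l in `F` makes β - l singular, and a field contains no nonzero singular matrix. -/
lemma eq_scalar_of_root (hK : IsField K) {β : Matrix (Fin 2) (Fin 2) F} (hβ : β ∈ K) (l : F)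
    (h : l ^ 2 - β.trace * l + β.det = 0) : β = l • 1 := by
  rw [← sub_eq_zero]
  refine eq_zero_of_det_eq_zero hK (K.sub_mem hβ (K.smul_mem K.one_mem l)) ?_
  rw [Matrix.det_fin_two, Matrix.trace_fin_two] at h
  rw [Matrix.det_fin_two]
  simp
  linear_combination h

lemma eq_scalar_of_entry (hK : IsField K) {β : Matrix (Fin 2) (Fin 2) F} (hβ : β ∈ K)
    (h : β 1 0 = 0) : β = β 0 0 • 1 := by
  refine eq_scalar_of_root hK hβ _ ?_
  rw [Matrix.det_fin_two, Matrix.trace_fin_two, h]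
  ring

lemma exists_entry_ne_zero (hK : IsField K) (hdim : Module.finrank F K = 2) :
    ∃ α ∈ K, α 1 0 ≠ 0 := by
  by_contra! h
  have : K = ⊥ := by
    rw [eq_bot_iff]
    intro β hβ
    rw [eq_scalar_of_entry hK hβ (h β hβ)]
    exact Subalgebra.smul_mem _ (Subalgebra.one_mem _) _
  rw [this, Subalgebra.finrank_bot] at hdim
  omega

variable {α : Matrix (Fin 2) (Fin 2) F}

lemma eq_combination (hK : IsField K) (hα : α ∈ K) (h0 : α 1 0 ≠ 0)
    {β : Matrix (Fin 2) (Fin 2) F} (hβ : β ∈ K) : ∃ x y : F, β = x • 1 + y • α := by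
  have h1 : β - (β 1 0 / α 1 0) • α ∈ K := K.sub_mem hβ (K.smul_mem hα _)
  have h2 := eq_scalar_of_entry hK h1 (by simp [h0])
  exact ⟨_, _, sub_eq_iff_eq_add.1 h2⟩

lemma mem_of_commute (hα : α ∈ K) (h0 : α 1 0 ≠ 0) {g : Matrix (Fin 2) (Fin 2) F}
    (hg : g * α = α * g) : g ∈ K := by
  have e00 := congr_fun₂ hg 0 0
  have e10 := congr_fun₂ hg 1 0
  rw [Matrix.mul_apply, Matrix.mul_apply, Fin.sum_univ_two, Fin.sum_univ_two] at e00 e10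
  have : g = (g 0 0 - g 1 0 / α 1 0 * α 0 0) • 1 + (g 1 0 / α 1 0) • α := by
    ext i j
    fin_cases i <;> fin_cases j <;> simp
    · field_simp
      linear_combination e00
    · field_simp
    · field_simp
      linear_combination e10
  rw [this]
  exact K.add_mem (K.smul_mem K.one_mem _) (K.smul_mem hα _)

/-- A matrix that induces by conjugation the nontrivial automorphism of the field generated
by `α`. -/
def frobMatrix (α : Matrix (Fin 2) (Fin 2) F) : Matrix (Fin 2) (Fin 2) F :=
  !![α 1 0, α 1 1 - α 0 0; 0, -α 1 0]

lemma frobMatrix_mul_self : frobMatrix α * frobMatrix α = (α 1 0 ^ 2) • 1 := by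
  ext i j
  fin_cases i <;> fin_cases j <;> simp [frobMatrix] <;> ring

/-- Identify `K` with F² by β ↦ βe₁, with e₁ the first basis vector. Then `frobMatrix α` is `α 1 0`
times the nontrivial automorphism, and conjugation in `K` is the adjugate. -/
lemma frobMatrix_mul (hK : IsField K) (hα : α ∈ K) (h0 : α 1 0 ≠ 0)
    {β : Matrix (Fin 2) (Fin 2) F} (hβ : β ∈ K) :
    frobMatrix α * β = β.adjugate * frobMatrix α := by
  obtain ⟨x, y, rfl⟩ := eq_combination hK hα h0 hβ
  rw [Matrix.adjugate_fin_two]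
  ext i j
  fin_cases i <;> fin_cases j <;>
    simp [frobMatrix, Matrix.mul_apply, Fin.sum_univ_two] <;> ring

/-- An upper triangular member of `K` is scalar; here this forces characteristic 2 and trace zero
for α. Every element of a finite field of characteristic 2 is a square, so α would have an
eigenvalue in `F`. -/
lemma frobMatrix_notMem [Finite F] (hK : IsField K) (hα : α ∈ K) (h0 : α 1 0 ≠ 0) :
    frobMatrix α ∉ K := by
  intro hw
  have h1 := eq_scalar_of_entry hK hw (by simp [frobMatrix])
  have h11 := congr_fun₂ h1 1 1
  have h01 := congr_fun₂ h1 0 1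
  simp [frobMatrix] at h11 h01
  have h2 : (2 : F) = 0 := by
    have : α 1 0 * 2 = 0 := by linear_combination -h11
    exact (mul_eq_zero.1 this).resolve_left h0
  have hchar : ringChar F = 2 := CharP.ringChar_of_prime_eq_zero Nat.prime_two (by exact_mod_cast h2)
  have := Fintype.ofFinite F
  obtain ⟨e, he⟩ := FiniteField.isSquare_of_char_two hchar α.det
  have h3 := eq_scalar_of_root hK hα e (by
    rw [Matrix.trace_fin_two, he]
    linear_combination (e ^ 2 - e * α 0 0) * h2 - e * h01)
  have := congr_fun₂ h3 1 0
  simp at this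
  exact h0 this

end QuadraticSubfield

/-! ### The non-split torus. -/

section NonsplitTorus

variable {F : Type*} [Field F] {T : Subgroup PGL(2, F)}

lemma IsNonsplitTorus.exists_isDihedralTorus [Finite F] (hT : IsNonsplitTorus T) :
    ∃ w, IsDihedralTorus T w := by
  obtain ⟨K, hK, hdim, rfl⟩ := hT
  obtain ⟨α, hα, h0⟩ := exists_entry_ne_zero hK hdim
  let w : GL (Fin 2) F := GeneralLinearGroup.mkOfDetNeZero (frobMatrix α) (by
    simp [frobMatrix, Matrix.det_fin_two, h0])
  have hw : (w : Matrix (Fin 2) (Fin 2) F) = frobMatrix α := rfl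
  refine ⟨ProjGenLinGroup.mk w, ⟨?_, ?_, ?_, ?_, ?_⟩⟩
  · intro a ha b hb
    induction a using ProjGenLinGroup.induction_on with
    | mk a =>
    induction b using ProjGenLinGroup.induction_on with
    | mk b =>
      have := hK.mul_comm ⟨_, mk_mem_unitsImage.1 ha⟩ ⟨_, mk_mem_unitsImage.1 hb⟩
      rw [← map_mul, ← map_mul]
      exact congr_arg _ (Units.ext (congr_arg Subtype.val this))
  · rw [← map_mul, mk_eq_one_iff, Units.val_mul, hw, frobMatrix_mul_self]
    simp
  · rw [mk_mem_unitsImage, hw]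
    exact frobMatrix_notMem hK hα h0
  · intro h hh
    induction h using ProjGenLinGroup.induction_on with
    | mk h =>
      rw [mk_mem_unitsImage] at hh
      rw [eq_inv_iff_mul_eq_one, ← map_mul, ← map_mul, ← map_mul, mk_eq_one_iff]
      have : (frobMatrix α * (h : Matrix (Fin 2) (Fin 2) F)) * frobMatrix α * h =
          (α 1 0 ^ 2 * (h : Matrix (Fin 2) (Fin 2) F).det) • 1 := by
        rw [frobMatrix_mul hK hα h0 hh, mul_assoc (adjugate _), frobMatrix_mul_self, mul_smul_comm,
          mul_one, smul_mul_assoc, Matrix.adjugate_mul, smul_smul]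
      rw [Units.val_mul, Units.val_mul, Units.val_mul, hw, this]
      simp
  · intro h hh h1 g hg
    induction h using ProjGenLinGroup.induction_on with
    | mk h =>
    induction g using ProjGenLinGroup.induction_on with
    | mk g =>
      rw [← map_inv, ← map_mul, ← map_mul] at hg
      rw [← map_mul, mk_mem_unitsImage, mk_mem_unitsImage, Units.val_mul, hw]
      rw [mk_mem_unitsImage] at hh hg
      have h10 : h 1 0 ≠ 0 := by
        intro h10
        have := eq_scalar_of_entry hK hh h10
        refine h1 (mk_eq_one_iff.2 ⟨?_, h10, ?_⟩)
        · rw [this]; simp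
        · nth_rw 2 [this]; simp
      have e := conj_entries g h
      have htr := trace_conj g h
      have hdet := det_conj g h
      generalize ((g⁻¹ * h * g : GL (Fin 2) F) : Matrix (Fin 2) (Fin 2) F) = γ at hg e htr hdet
      have hadj : (h : Matrix (Fin 2) (Fin 2) F).adjugate =
          (h : Matrix (Fin 2) (Fin 2) F).trace • 1 - (h : Matrix (Fin 2) (Fin 2) F) := by
        ext i j
        fin_cases i <;> fin_cases j <;> simp [Matrix.adjugate_fin_two, Matrix.trace_fin_two]
      have hadjK : (h : Matrix (Fin 2) (Fin 2) F).adjugate ∈ K := by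
        rw [hadj]
        exact K.sub_mem (K.smul_mem K.one_mem _) hh
      have hcomm : γ * h = (h : Matrix (Fin 2) (Fin 2) F) * γ :=
        congr_arg Subtype.val (hK.mul_comm ⟨γ, hg⟩ ⟨_, hh⟩)
      have hCH : γ * γ - γ.trace • γ + γ.det • 1 = 0 := by
        ext i j
        fin_cases i <;> fin_cases j <;>
          simp [Matrix.mul_apply, Fin.sum_univ_two, Matrix.det_fin_two, Matrix.trace_fin_two] <;>
          ring
      -- γ is conjugate to h, so it is a root in `K` of the characteristic polynomial of h, whose
      -- roots there are h and its adjugate. In the first case g centralizes h, in the second g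
      -- times the Weyl matrix does.
      have hprod : (γ - h) * (γ - (h : Matrix (Fin 2) (Fin 2) F).adjugate) = 0 := by
        have h3 : (h : Matrix (Fin 2) (Fin 2) F) * (h : Matrix (Fin 2) (Fin 2) F).adjugate =
          (h : Matrix (Fin 2) (Fin 2) F).det • 1 := Matrix.mul_adjugate _
        rw [sub_mul, mul_sub, mul_sub, h3, hadj, mul_sub, mul_smul_comm, mul_one, hcomm, ← htr,
          ← hdet, ← hCH]
        abel
      have hcases : γ = h ∨ γ = (h : Matrix (Fin 2) (Fin 2) F).adjugate := by
        have h4 := congr_arg Matrix.det hprod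
        rw [Matrix.det_mul, Matrix.det_zero, mul_eq_zero] at h4
        exact h4.imp (fun h4 => sub_eq_zero.1 (eq_zero_of_det_eq_zero hK (K.sub_mem hg hh) h4))
          (fun h4 => sub_eq_zero.1 (eq_zero_of_det_eq_zero hK (K.sub_mem hg hadjK) h4))
      rcases hcases with rfl | rfl
      · exact Or.inl (mem_of_commute hh h10 e)
      · refine Or.inr (mem_of_commute hh h10 ?_)
        rw [mul_assoc, frobMatrix_mul hK hα h0 hh, ← mul_assoc, e, mul_assoc]

/-- An upper triangular conjugate would exhibit an eigenvalue of h in `F`. -/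
lemma IsNonsplitTorus.conj_notMem_borel (hT : IsNonsplitTorus T) {h : PGL(2, F)} (hh : h ∈ T)
    (h1 : h ≠ 1) (g : PGL(2, F)) : g⁻¹ * h * g ∉ borel F := by
  obtain ⟨K, hK, hdim, rfl⟩ := hT
  intro hg
  induction h using ProjGenLinGroup.induction_on with
  | mk h =>
  induction g using ProjGenLinGroup.induction_on with
  | mk g =>
    rw [← map_inv, ← map_mul, ← map_mul, mk_mem_borel] at hg
    rw [mk_mem_unitsImage] at hh
    have htr := trace_conj g h
    have hdet := det_conj g h
    generalize ((g⁻¹ * h * g : GL (Fin 2) F) : Matrix (Fin 2) (Fin 2) F) = γ at hg htr hdet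
    have := eq_scalar_of_root hK hh (γ 0 0) (by
      rw [← htr, ← hdet, Matrix.trace_fin_two, Matrix.det_fin_two, hg]
      ring)
    refine h1 (mk_eq_one_iff.2 ?_)
    rw [this]
    simp

lemma IsNonsplitTorus.card [Finite F] (hT : IsNonsplitTorus T) :
    Nat.card T = Nat.card F + 1 := by
  obtain ⟨K, hK, hdim, rfl⟩ := hT
  obtain ⟨α, hα, h0⟩ := exists_entry_ne_zero hK hdim
  have hmem : ∀ x : F, α + x • 1 ∈ K := fun x => K.add_mem hα (K.smul_mem K.one_mem _)
  have hdet : ∀ x : F, (α + x • 1).det ≠ 0 := by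
    intro x hx
    have := congr_fun₂ (eq_zero_of_det_eq_zero hK (hmem x) hx) 1 0
    simp at this
    exact h0 this
  -- Up to scaling, the nonzero elements of K = F + Fα are 1 and the α + x.
  let e : Option F → unitsImage K := fun o => o.elim 1 fun x =>
    ⟨ProjGenLinGroup.mk (GeneralLinearGroup.mkOfDetNeZero _ (hdet x)),
      mk_mem_unitsImage.2 (hmem x)⟩
  have he : Function.Bijective e := by
    constructor
    · have key : ∀ x, e (some x) ≠ 1 := by
        intro x hx
        have := (mk_eq_one_iff.1 (congr_arg Subtype.val hx)).2.1
        simp [GeneralLinearGroup.mkOfDetNeZero] at this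
        exact h0 this
      rintro (_ | x) (_ | y) hxy
      · rfl
      · exact absurd hxy.symm (key y)
      · exact absurd hxy (key x)
      · obtain ⟨u, hu⟩ := ProjGenLinGroup.mk_eq_mk_iff.1 (congr_arg Subtype.val hxy)
        have h : (u : F) • (α + x • 1) = α + y • 1 := by
          have := congr_arg (fun g : GL (Fin 2) F => (g : Matrix (Fin 2) (Fin 2) F)) hu
          rwa [coe_mul_scalar] at this
        have h10 := congr_fun₂ h 1 0
        have h00 := congr_fun₂ h 0 0
        simp at h10 h00
        have hu : (u : F) = 1 := by
          exact mul_right_cancel₀ h0 (h10.trans (one_mul _).symm)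
        rw [hu, one_mul] at h00
        rw [add_left_cancel h00]
    · rintro ⟨s, hs⟩
      induction s using ProjGenLinGroup.induction_on with
      | mk g =>
        have hg := mk_mem_unitsImage.1 hs
        obtain ⟨x, y, hxy⟩ := eq_combination hK hα h0 hg
        by_cases hy : y = 0
        · refine ⟨none, Subtype.ext ?_⟩
          symm
          refine mk_eq_one_iff.2 ?_
          rw [hxy, hy]
          simp
        · refine ⟨some (x / y), Subtype.ext ?_⟩
          refine ProjGenLinGroup.mk_eq_mk_iff.2 ⟨Units.mk0 y hy, Units.ext ?_⟩
          rw [coe_mul_scalar, hxy]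
          change y • (α + (x / y) • 1) = _
          rw [smul_add, smul_smul, mul_div_cancel₀ _ hy, add_comm]
  rw [← Nat.card_congr (Equiv.ofBijective e he), Finite.card_option]

lemma IsNonsplitTorus.isCyclic [Finite F] (hT : IsNonsplitTorus T) : IsCyclic T := by
  obtain ⟨K, hK, hdim, rfl⟩ := hT
  let : Field K := hK.toField
  have : Finite K := inferInstance
  let φ : Kˣ →* unitsImage K := MonoidHom.mk'
    (fun u => ⟨ProjGenLinGroup.mk (Units.map K.val.toMonoidHom u),
      mk_mem_unitsImage.2 (u : K).2⟩) fun u v => Subtype.ext (by simp)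
  refine isCyclic_of_surjective φ ?_
  rintro ⟨s, hs⟩
  induction s using ProjGenLinGroup.induction_on with
  | mk g =>
    have hg := mk_mem_unitsImage.1 hs
    have hg0 : (⟨_, hg⟩ : K) ≠ 0 := by
      intro h
      have h0 : (g : Matrix (Fin 2) (Fin 2) F) = 0 := congr_arg Subtype.val h
      exact g.det_ne_zero (by rw [h0, Matrix.det_zero])
    refine ⟨Units.mk0 _ hg0, Subtype.ext ?_⟩
    exact congr_arg ProjGenLinGroup.mk (Units.ext rfl)

end NonsplitTorus

/-! ### Sums of class functions on PGL₂. -/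

section SumFormula

variable {F : Type*} [Field F]

section

variable [Finite F]

instance : Finite PGL(2, F) := Finite.of_surjective _ ProjGenLinGroup.mk_surjective

lemma two_le_card : 2 ≤ Nat.card F := Finite.one_lt_card

lemma card_ne_zero : (Nat.card F : ℂ) ≠ 0 := by
  have := two_le_card (F := F)
  exact_mod_cast (by omega : Nat.card F ≠ 0)

lemma card_sub_one_ne_zero : (Nat.card F : ℂ) - 1 ≠ 0 := by
  have := two_le_card (F := F)
  rw [sub_ne_zero]
  exact_mod_cast (by omega : Nat.card F ≠ 1)

lemma card_add_one_ne_zero {F : Type*} : (Nat.card F : ℂ) + 1 ≠ 0 := by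
  exact_mod_cast (by omega : Nat.card F + 1 ≠ 0)

lemma card_PGL_complex :
    (Nat.card PGL(2, F) : ℂ) = Nat.card F * ((Nat.card F : ℂ) - 1) * (Nat.card F + 1) := by
  have := congr_arg (fun z : ℤ => (z : ℂ)) (card_PGL (F := F))
  push_cast at this
  rw [this]
  ring

lemma card_splitTorus_complex : (Nat.card (splitTorus F) : ℂ) = Nat.card F - 1 := by
  have := two_le_card (F := F)
  rw [card_splitTorus, Nat.cast_sub (by omega), Nat.cast_one]

lemma IsNonsplitTorus.card_complex {T : Subgroup PGL(2, F)} (hT : IsNonsplitTorus T) :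
    (Nat.card T : ℂ) = Nat.card F + 1 := by
  rw [hT.card, Nat.cast_add, Nat.cast_one]

end

lemma apply_unip_of_ne_zero {f : PGL(2, F) → ℂ} (hf : ∀ g h, f (h * g * h⁻¹) = f g) {x : F}
    (hx : x ≠ 0) : f (unip x) = f (unip 1) := by
  have := diagElt_conj_unip (Units.mk0 x hx) 1
  rw [Units.val_mk0, mul_one] at this
  rw [← this, hf]

lemma sum_unipotentGroup [Finite F] [Fintype (unipotentGroup F)] {f : PGL(2, F) → ℂ}
    (hf : ∀ g h, f (h * g * h⁻¹) = f g) :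
    ∑ u : unipotentGroup F, f u - f 1 = (Nat.card F - 1) * f (unip 1) := by
  classical
  have := Fintype.ofFinite F
  have h1 : ∑ u : unipotentGroup F, f u = ∑ x : F, f (unip x) := by
    let e : F → unipotentGroup F := fun x => ⟨unip x, x, rfl⟩
    have he : Function.Bijective e := by
      refine ⟨fun x y hxy => unip_injective (congr_arg Subtype.val hxy), ?_⟩
      rintro ⟨_, x, rfl⟩
      exact ⟨x, rfl⟩
    exact (_root_.Equiv.sum_comp (Equiv.ofBijective e he) fun u : unipotentGroup F => f u).symm
  rw [h1, ← Finset.add_sum_erase _ _ (Finset.mem_univ 0), unip_zero, add_sub_cancel_left,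
    Finset.sum_congr rfl fun x hx => apply_unip_of_ne_zero hf (Finset.ne_of_mem_erase hx),
    Finset.sum_const, Finset.card_erase_of_mem (Finset.mem_univ _), Finset.card_univ, nsmul_eq_mul,
    Nat.card_eq_fintype_card, Nat.cast_sub Fintype.card_pos, Nat.cast_one]

lemma split_conj_notMem_unipotent {s : PGL(2, F)} (hs : s ∈ splitTorus F) (h1 : s ≠ 1)
    (g : PGL(2, F)) : g⁻¹ * s * g ∉ unipotentGroup F := by
  intro hg
  induction s using ProjGenLinGroup.induction_on with
  | mk h =>
  induction g using ProjGenLinGroup.induction_on with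
  | mk g =>
    have h2 := mk_mem_splitTorus.1 hs
    rw [← map_inv, ← map_mul, ← map_mul, mk_mem_unipotentGroup] at hg
    have htr := trace_conj g h
    have hdet := det_conj g h
    rw [Matrix.trace_fin_two, Matrix.trace_fin_two] at htr
    rw [Matrix.det_fin_two, Matrix.det_fin_two, hg.1, h2.1] at hdet
    refine h1 (mk_eq_one_iff.2 ⟨h2.1, h2.2, ?_⟩)
    rw [← sub_eq_zero, ← sq_eq_zero_iff]
    rw [hg.2] at htr hdet
    -- This compares discriminants trace² - 4 det: zero for the conjugate, (h₀₀ - h₁₁)² for h.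
    linear_combination -(h 0 0 + h 1 1 + 2 * (g⁻¹ * h * g : GL (Fin 2) F) 1 1) * htr + 4 * hdet

lemma unipotentGroup_le_borel : unipotentGroup F ≤ borel F := by
  intro u hu
  induction u using ProjGenLinGroup.induction_on with
  | mk g => exact mk_mem_borel.2 (mk_mem_unipotentGroup.1 hu).1

lemma splitTorus_le_borel : splitTorus F ≤ borel F := by
  intro u hu
  induction u using ProjGenLinGroup.induction_on with
  | mk g => exact mk_mem_borel.2 (mk_mem_splitTorus.1 hu).2

open scoped Classical in
/-- The nontrivial elements of `G` that are conjugate to an element of `H`. -/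
def conjugates {G : Type*} [Group G] [Fintype G] (H : Subgroup G) : Finset G :=
  Finset.univ.filter fun x => x ≠ 1 ∧ ∃ g : G, g⁻¹ * x * g ∈ H

lemma mem_conjugates {G : Type*} [Group G] [Fintype G] {H : Subgroup G} {x : G} :
    x ∈ conjugates H ↔ x ≠ 1 ∧ ∃ g : G, g⁻¹ * x * g ∈ H := by
  simp [conjugates]

lemma disjoint_conjugates {G : Type*} [Group G] [Fintype G] {H H' : Subgroup G}
    (h : ∀ x ∈ H, x ≠ 1 → ∀ g : G, g⁻¹ * x * g ∉ H') :
    Disjoint (conjugates H) (conjugates H') := by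
  rw [Finset.disjoint_left]
  intro x hx hx'
  obtain ⟨hx1, g, hg⟩ := mem_conjugates.1 hx
  obtain ⟨-, g', hg'⟩ := mem_conjugates.1 hx'
  refine h _ hg (fun h => hx1 ?_) (g⁻¹ * g') (by convert hg' using 1; group)
  have : x = g * (g⁻¹ * x * g) * g⁻¹ := by group
  rw [this, h]
  simp

variable [Finite F] [Fintype PGL(2, F)]

lemma sum_conjugates_unipotent {f : PGL(2, F) → ℂ} (hf : ∀ g h, f (h * g * h⁻¹) = f g) :
    ∑ x ∈ conjugates (unipotentGroup F), f x = ((Nat.card F : ℂ) ^ 2 - 1) * f (unip 1) := by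
  have : Finite (unipotentGroup F) := inferInstance
  have := Fintype.ofFinite (unipotentGroup F)
  have h := sum_conj_mem (unipotentGroup F) (Nat.card F * (Nat.card F - 1)) (fun h hh h1 => by
    rw [← card_borel]
    exact Nat.card_congr (Equiv.subtypeEquivRight fun g => unip_conj_mem_iff hh h1 g)) f hf
  rw [sum_unipotentGroup hf, card_PGL_complex, Nat.cast_mul,
    Nat.cast_sub (by have := two_le_card (F := F); omega), Nat.cast_one] at h
  apply mul_left_cancel₀ (mul_ne_zero (card_ne_zero (F := F)) (card_sub_one_ne_zero (F := F)))
  refine h.trans ?_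
  ring

lemma sum_conjugates_split [Fintype (splitTorus F)] {f : PGL(2, F) → ℂ}
    (hf : ∀ g h, f (h * g * h⁻¹) = f g) :
    ∑ x ∈ conjugates (splitTorus F), f x =
      Nat.card F * (Nat.card F + 1) / 2 * (∑ s : splitTorus F, f s - f 1) := by
  have h := sum_conj_mem (splitTorus F) (2 * Nat.card (splitTorus F))
    (fun h hh h1 => isDihedralTorus_splitTorus.card_conj_mem hh h1) f hf
  rw [card_PGL_complex, Nat.cast_mul, card_splitTorus_complex] at h
  have h0 := card_sub_one_ne_zero (F := F)
  apply mul_left_cancel₀ (mul_ne_zero two_ne_zero h0)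
  push_cast at h
  refine h.trans ?_
  field_simp

variable {T : Subgroup PGL(2, F)} (hT : IsNonsplitTorus T)
include hT

lemma sum_conjugates_nonsplit [Fintype T] {f : PGL(2, F) → ℂ}
    (hf : ∀ g h, f (h * g * h⁻¹) = f g) :
    ∑ x ∈ conjugates T, f x =
      Nat.card F * (Nat.card F - 1) / 2 * (∑ t : T, f t - f 1) := by
  obtain ⟨w, hw⟩ := hT.exists_isDihedralTorus
  have h := sum_conj_mem T (2 * Nat.card T) (fun h hh h1 => hw.card_conj_mem hh h1) f hf
  rw [card_PGL_complex, Nat.cast_mul, hT.card_complex] at h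
  have h0 := card_add_one_ne_zero (F := F)
  apply mul_left_cancel₀ (mul_ne_zero two_ne_zero h0)
  push_cast at h
  refine h.trans ?_
  field_simp

/-- The sum of a class function on `PGL₂` of a finite field in terms of its restrictions to the
unipotent group and to the two maximal tori. -/
lemma sum_classFunction [Fintype (splitTorus F)] [Fintype T] {f : PGL(2, F) → ℂ}
    (hf : ∀ g h, f (h * g * h⁻¹) = f g) :
    ∑ g, f g = f 1 + ((Nat.card F : ℂ) ^ 2 - 1) * f (unip 1)
      + Nat.card F * (Nat.card F + 1) / 2 * (∑ s : splitTorus F, f s - f 1)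
      + Nat.card F * (Nat.card F - 1) / 2 * (∑ t : T, f t - f 1) := by
  classical
  have d1 : Disjoint (conjugates (splitTorus F)) (conjugates (unipotentGroup F)) :=
    disjoint_conjugates fun x hx h1 g => split_conj_notMem_unipotent hx h1 g
  have d2 : Disjoint (conjugates T) (conjugates (splitTorus F)) :=
    disjoint_conjugates fun x hx h1 g h => hT.conj_notMem_borel hx h1 g (splitTorus_le_borel h)
  have d3 : Disjoint (conjugates T) (conjugates (unipotentGroup F)) :=
    disjoint_conjugates fun x hx h1 g h => hT.conj_notMem_borel hx h1 g (unipotentGroup_le_borel h)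
  have d4 : Disjoint (conjugates (unipotentGroup F)) (conjugates (splitTorus F) ∪ conjugates T) :=
    Finset.disjoint_union_right.2 ⟨d1.symm, d3.symm⟩
  have d5 : Disjoint {1} (conjugates (unipotentGroup F) ∪
      (conjugates (splitTorus F) ∪ conjugates T)) := by
    rw [Finset.disjoint_singleton_left]
    simp [mem_conjugates]
  have key : ∀ f : PGL(2, F) → ℂ, (∀ g h, f (h * g * h⁻¹) = f g) →
      ∑ x ∈ {1} ∪ (conjugates (unipotentGroup F) ∪ (conjugates (splitTorus F) ∪ conjugates T)),
        f x = f 1 + ((Nat.card F : ℂ) ^ 2 - 1) * f (unip 1)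
      + Nat.card F * (Nat.card F + 1) / 2 * (∑ s : splitTorus F, f s - f 1)
      + Nat.card F * (Nat.card F - 1) / 2 * (∑ t : T, f t - f 1) := by
    intro f hf
    rw [Finset.sum_union d5, Finset.sum_union d4, Finset.sum_union d2.symm, Finset.sum_singleton,
      sum_conjugates_unipotent hf, sum_conjugates_split hf, sum_conjugates_nonsplit hT hf]
    ring
  -- The formula with f = 1 counts the disjoint pieces and gives the order of G, so they exhaust G
  -- without any appeal to normal forms.
  have hall : {1} ∪ (conjugates (unipotentGroup F) ∪ (conjugates (splitTorus F) ∪ conjugates T)) =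
      Finset.univ := by
    apply Finset.eq_univ_of_card
    have h := key (fun _ => 1) fun _ _ => rfl
    simp only [Finset.sum_const, nsmul_eq_mul, mul_one, Finset.card_univ,
      ← Nat.card_eq_fintype_card] at h
    rw [card_splitTorus_complex, hT.card_complex] at h
    have h2 := h.trans (show _ = (Nat.card PGL(2, F) : ℂ) by rw [card_PGL_complex]; ring)
    rw [← Nat.card_eq_fintype_card]
    exact_mod_cast h2
  rw [← hall]
  exact key f hf

end SumFormula

/-! ### Pairings and triple products through the tori. -/

section TorusData

variable {F : Type*} [Field F]

open scoped Classical in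
/-- A class function on `PGL₂` that behaves on the tori and on unipotent elements like a
representation with multiplicity `m` of the nontrivial characters of `U`: `k` is the excess over
`m` copies of the regular character on `S`, and `l` is the deficiency on `T`. -/
structure TorusData (T : Subgroup PGL(2, F)) (f : PGL(2, F) → ℂ) (m a : ℂ)
    (k : splitTorus F → ℂ) (l : T → ℂ) : Prop where
  conj : ∀ g h, f (h * g * h⁻¹) = f g
  one : f 1 = m * Nat.card F + a
  unip : f (unip 1) = a
  split : ∀ s : splitTorus F, f s = k s + if s = 1 then m * (Nat.card F - 1) else 0
  nonsplit : ∀ t : T, f t = (if t = 1 then m * (Nat.card F + 1) else 0) - l t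

namespace TorusData

variable {T : Subgroup PGL(2, F)} {f f' f'' : PGL(2, F) → ℂ} {m a m' a' a'' : ℂ}
  {k k' k'' : splitTorus F → ℂ} {l l' l'' : T → ℂ}

open scoped Classical in
lemma of_classFunction (hf : ∀ g h, f (h * g * h⁻¹) = f g)
    (h1 : f 1 = m * Nat.card F + a) (hu : f (FinitePGLTwo.unip 1) = a) :
    TorusData T f m a (fun s => f s - if s = 1 then m * (Nat.card F - 1) else 0)
      (fun t => (if t = 1 then m * (Nat.card F + 1) else 0) - f t) :=
  ⟨hf, h1, hu, fun s => by ring, fun t => by ring⟩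

lemma k_one (h : TorusData T f m a k l) : k 1 = a + m := by
  have h1 := h.split 1
  rw [if_pos rfl, Subgroup.coe_one, h.one] at h1
  linear_combination -h1

lemma l_one (h : TorusData T f m a k l) : l 1 = m - a := by
  have h1 := h.nonsplit 1
  rw [if_pos rfl, Subgroup.coe_one, h.one] at h1
  linear_combination h1

lemma apply_split_of_ne (h : TorusData T f m a k l) {s : splitTorus F} (hs : s ≠ 1) :
    f s = k s := by
  rw [h.split, if_neg hs, add_zero]

lemma apply_nonsplit_of_ne (h : TorusData T f m a k l) {t : T} (ht : t ≠ 1) :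
    f t = -l t := by
  rw [h.nonsplit, if_neg ht, zero_sub]

lemma comp_inv [Finite F] (h : TorusData T f m a k l) :
    TorusData T (fun g => f g⁻¹) m a (fun s => k s⁻¹) (fun t => l t⁻¹) where
  conj g x := by
    rw [← h.conj g⁻¹ x]
    congr 1
    group
  one := by rw [inv_one, h.one]
  unip := by
    have : (FinitePGLTwo.unip (1 : F))⁻¹ = FinitePGLTwo.unip (-1) := by
      rw [inv_eq_iff_mul_eq_one, ← unip_add, add_neg_cancel, unip_zero]
    rw [this, apply_unip_of_ne_zero h.conj (neg_ne_zero.2 one_ne_zero), h.unip]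
  split s := by
    rw [← Subgroup.coe_inv, h.split]
    by_cases hs : s = 1
    · rw [if_pos hs, if_pos (_root_.inv_eq_one.2 hs)]
    · rw [if_neg hs, if_neg fun h' => hs (_root_.inv_eq_one.1 h')]
  nonsplit s := by
    rw [← Subgroup.coe_inv, h.nonsplit]
    by_cases hs : s = 1
    · rw [if_pos hs, if_pos (_root_.inv_eq_one.2 hs)]
    · rw [if_neg hs, if_neg fun h' => hs (_root_.inv_eq_one.1 h')]

end TorusData

lemma sum_sub_apply_one {A : Type*} [Group A] [Fintype A] {φ ψ : A → ℂ}
    (h : ∀ a ≠ 1, φ a = ψ a) : ∑ a, φ a - φ 1 = ∑ a, ψ a - ψ 1 := by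
  classical
  rw [← Finset.add_sum_erase _ _ (Finset.mem_univ (1 : A)),
    ← Finset.add_sum_erase _ ψ (Finset.mem_univ (1 : A)), add_sub_cancel_left, add_sub_cancel_left]
  exact Finset.sum_congr rfl fun a ha => h a (Finset.ne_of_mem_erase ha)

namespace TorusData

variable [Finite F] {T : Subgroup PGL(2, F)} (hT : IsNonsplitTorus T)
  {f f' f'' : PGL(2, F) → ℂ} {m a m' a' a'' : ℂ}
  {k k' k'' : splitTorus F → ℂ} {l l' l'' : T → ℂ}
  [Fintype PGL(2, F)] [Fintype (splitTorus F)] [Fintype T]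

include hT

/-- With f(1) = mq + a, k(1) = a + m and l(1) = m - a, the coefficients of mm', ma', am' and aa'
coming from 1, u and the corrections at the identity of the tori all cancel. -/
lemma average_mul (h : TorusData T f m a k l) (h' : TorusData T f' m' a' k' l') :
    (Nat.card PGL(2, F) : ℂ)⁻¹ * ∑ g, f g * f' g =
      ((Nat.card (splitTorus F) : ℂ)⁻¹ * ∑ s, k s * k' s +
        (Nat.card T : ℂ)⁻¹ * ∑ t, l t * l' t) / 2 := by
  have hc : ∀ g x, f (x * g * x⁻¹) * f' (x * g * x⁻¹) = f g * f' g := fun g x => by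
    rw [h.conj, h'.conj]
  rw [sum_classFunction hT hc]
  have h1 := sum_sub_apply_one (φ := fun s : splitTorus F => f s * f' s) (ψ := fun s => k s * k' s)
    fun s hs => by rw [h.apply_split_of_ne hs, h'.apply_split_of_ne hs]
  have h2 := sum_sub_apply_one (φ := fun s : T => f s * f' s) (ψ := fun s => l s * l' s)
    fun s hs => by rw [h.apply_nonsplit_of_ne hs, h'.apply_nonsplit_of_ne hs, neg_mul_neg]
  simp only [Subgroup.coe_one] at h1 h2
  rw [h1, h2, h.one, h'.one, h.unip, h'.unip, h.k_one, h'.k_one, h.l_one, h'.l_one,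
    card_PGL_complex, card_splitTorus_complex, hT.card_complex]
  have q0 := card_ne_zero (F := F)
  have q1 := card_sub_one_ne_zero (F := F)
  have q2 := card_add_one_ne_zero (F := F)
  field_simp
  ring

/-- The same bookkeeping as in `average_mul`, but now the terms not involving the torus sums add up
to the order q³ - q of G, which gives the summand 1. -/
lemma average_mul_mul (h : TorusData T f 1 a k l) (h' : TorusData T f' 1 a' k' l')
    (h'' : TorusData T f'' 1 a'' k'' l'') :
    (Nat.card PGL(2, F) : ℂ)⁻¹ * ∑ g, f g * f' g * f'' g =
      1 + ((Nat.card (splitTorus F) : ℂ)⁻¹ * ∑ s, k s * k' s * k'' s -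
        (Nat.card T : ℂ)⁻¹ * ∑ t, l t * l' t * l'' t) / 2 := by
  have hc : ∀ g x, f (x * g * x⁻¹) * f' (x * g * x⁻¹) * f'' (x * g * x⁻¹) = f g * f' g * f'' g :=
    fun g x => by rw [h.conj, h'.conj, h''.conj]
  rw [sum_classFunction hT hc]
  have h1 := sum_sub_apply_one (φ := fun s : splitTorus F => f s * f' s * f'' s)
    (ψ := fun s => k s * k' s * k'' s) fun s hs => by
      rw [h.apply_split_of_ne hs, h'.apply_split_of_ne hs, h''.apply_split_of_ne hs]
  have h2 := sum_sub_apply_one (φ := fun s : T => f s * f' s * f'' s)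
    (ψ := fun s => -(l s * l' s * l'' s)) fun s hs => by
      rw [h.apply_nonsplit_of_ne hs, h'.apply_nonsplit_of_ne hs, h''.apply_nonsplit_of_ne hs]
      ring
  simp only [Subgroup.coe_one, Finset.sum_neg_distrib] at h1 h2
  rw [h1, h2, h.one, h'.one, h''.one, h.unip, h'.unip, h''.unip, h.k_one, h'.k_one, h''.k_one,
    h.l_one, h'.l_one, h''.l_one, card_PGL_complex, card_splitTorus_complex, hT.card_complex]
  have q0 := card_ne_zero (F := F)
  have q1 := card_sub_one_ne_zero (F := F)
  have q2 := card_add_one_ne_zero (F := F)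
  field_simp
  ring

end TorusData

end TorusData

/-! ### Quadratic characters of the tori. -/

section QuadraticCharacters

variable {F : Type*} [Field F]

lemma detChar_mk (η : Fˣ →* ℂˣ) (hη : η ^ 2 = 1) (g : GL (Fin 2) F) :
    detChar η hη (ProjGenLinGroup.mk g) = η (GeneralLinearGroup.det g) := rfl

lemma detChar_diagHom (η : Fˣ →* ℂˣ) (hη : η ^ 2 = 1) (a : Fˣ) :
    detChar η hη (diagHom F a) = η a := by
  change detChar η hη (ProjGenLinGroup.mk _) = η a
  rw [detChar_mk]
  congr 1
  ext
  simp [GeneralLinearGroup.mkOfDetNeZero]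

lemma detChar_unip (η : Fˣ →* ℂˣ) (hη : η ^ 2 = 1) (x : F) : detChar η hη (unip x) = 1 := by
  rw [unip, detChar_mk]
  convert map_one η
  ext
  simp

lemma detChar_mul_self (η : Fˣ →* ℂˣ) (hη : η ^ 2 = 1) (g : PGL(2, F)) :
    detChar η hη g * detChar η hη g = 1 := by
  induction g using ProjGenLinGroup.induction_on with
  | mk g =>
    rw [detChar_mk, ← sq, ← MonoidHom.pow_apply, hη, MonoidHom.one_apply]

/-- The restriction of `η ∘ det` to a subgroup. -/
def detCharRes (H : Subgroup PGL(2, F)) (η : Fˣ →* ℂˣ) (hη : η ^ 2 = 1) : H →* ℂˣ :=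
  (detChar η hη).comp H.subtype

lemma detCharRes_apply (H : Subgroup PGL(2, F)) (η : Fˣ →* ℂˣ) (hη : η ^ 2 = 1) (h : H) :
    detCharRes H η hη h = detChar η hη h := rfl

lemma detCharRes_split_injective {η η' : Fˣ →* ℂˣ} {hη : η ^ 2 = 1} {hη' : η' ^ 2 = 1}
    (h : detCharRes (splitTorus F) η hη = detCharRes (splitTorus F) η' hη') : η = η' := by
  ext a
  have := DFunLike.congr_fun h (diagHom F a)
  rw [detCharRes_apply, detCharRes_apply, detChar_diagHom, detChar_diagHom] at this
  rw [this]

lemma one_sq_monoidHom : (1 : Fˣ →* ℂˣ) ^ 2 = 1 := by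
  ext
  simp

lemma detChar_one : detChar (1 : Fˣ →* ℂˣ) one_sq_monoidHom = 1 := by
  ext g
  induction g using ProjGenLinGroup.induction_on with
  | mk g => rfl

lemma detCharRes_one (H : Subgroup PGL(2, F)) :
    detCharRes H (1 : Fˣ →* ℂˣ) one_sq_monoidHom = 1 := by
  rw [detCharRes, detChar_one]
  rfl

lemma exists_eq_detCharRes_split (χ : splitTorus F →* ℂˣ) (hχ : χ * χ = 1) :
    ∃ (η : Fˣ →* ℂˣ) (hη : η ^ 2 = 1), χ = detCharRes (splitTorus F) η hη := by
  have hη : (χ.comp (diagHom F)) ^ 2 = 1 := by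
    ext a
    have := DFunLike.congr_fun hχ (diagHom F a)
    rw [MonoidHom.pow_apply, sq]
    exact congr_arg _ this
  refine ⟨χ.comp (diagHom F), hη, ?_⟩
  ext s
  obtain ⟨a, rfl⟩ := diagHom_bijective.2 s
  rw [detCharRes_apply, detChar_diagHom]
  rfl

variable {T : Subgroup PGL(2, F)}

lemma torusData_detChar (T : Subgroup PGL(2, F)) (η : Fˣ →* ℂˣ) (hη : η ^ 2 = 1) :
    TorusData T (fun g => detChar η hη g) 0 1 (fun s => detCharRes (splitTorus F) η hη s)
      (fun t => -(detCharRes T η hη t : ℂ)) where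
  conj g h := by rw [map_mul, map_mul, mul_comm (detChar η hη h), map_inv, mul_inv_cancel_right]
  one := by simp
  unip := by rw [detChar_unip, Units.val_one]
  split s := by simp [detCharRes_apply]
  nonsplit t := by simp [detCharRes_apply]

variable [Finite F] (hT : IsNonsplitTorus T)
include hT

/-- If η ∘ det were trivial on T, pairing it with the trivial character by `average_mul` would give
0 on G, 0 on S and 1 on T, that is 0 = 1/2. -/
lemma detCharRes_nonsplit_ne_one {η : Fˣ →* ℂˣ} (hη : η ^ 2 = 1) (h1 : η ≠ 1) :
    detCharRes T η hη ≠ 1 := by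
  intro h
  have := Fintype.ofFinite PGL(2, F)
  have := Fintype.ofFinite (splitTorus F)
  have := Fintype.ofFinite T
  have hsplit : detCharRes (splitTorus F) η hη ≠ 1 := by
    intro h'
    refine h1 (detCharRes_split_injective (hη := hη) (hη' := one_sq_monoidHom) ?_)
    rw [h']
    ext s
    obtain ⟨a, rfl⟩ := diagHom_bijective.2 s
    rw [detCharRes_apply, detChar_diagHom]
    rfl
  have hG : detChar η hη ≠ 1 := fun h' => hsplit (by rw [detCharRes, h']; rfl)
  have key := (torusData_detChar T η hη).average_mul hT (torusData_detChar T 1 (one_sq_monoidHom))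
  simp only [detCharRes_one, detChar_one, MonoidHom.one_apply, Units.val_one, mul_one] at key
  rw [sum_hom_units, sum_hom_units, if_neg hG, if_neg hsplit, h] at key
  simp only [mul_zero, zero_add, MonoidHom.one_apply, Units.val_one, neg_mul_neg, mul_one,
    Finset.sum_const, Finset.card_univ, nsmul_eq_mul, Nat.card_eq_fintype_card] at key
  rw [inv_mul_cancel₀ (by simp [Fintype.card_ne_zero])] at key
  norm_num at key

lemma exists_eq_detCharRes_nonsplit (χ : T →* ℂˣ) (hχ : χ * χ = 1) :
    ∃ (η : Fˣ →* ℂˣ) (hη : η ^ 2 = 1), χ = detCharRes T η hη := by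
  obtain ⟨t, ht⟩ := hT.isCyclic.exists_generator
  have hext : ∀ χ' : T →* ℂˣ, χ t = χ' t → χ = χ' := by
    intro χ' h
    ext s
    obtain ⟨n, rfl⟩ := Subgroup.mem_zpowers_iff.1 (ht s)
    rw [map_zpow, map_zpow, h]
  have hsq : ∀ {χ : T →* ℂˣ}, χ * χ = 1 → χ t = 1 ∨ χ t = -1 := by
    intro χ hχ
    have h := congr_arg (fun u : ℂˣ => (u : ℂ)) (DFunLike.congr_fun hχ t)
    have h : ((χ t : ℂˣ) : ℂ) * χ t = 1 := h
    rcases mul_self_eq_one_iff.1 h with h | h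
    · exact Or.inl (Units.ext h)
    · exact Or.inr (Units.ext (by rw [h, Units.val_neg, Units.val_one]))
  rcases hsq hχ with h | h
  · exact ⟨1, one_sq_monoidHom, hext _ (by rw [h, detCharRes_one]; rfl)⟩
  -- A value -1 on a generator forces q + 1 to be even, so q - 1 is even and `F` has a quadratic
  -- character η ≠ 1. As T is cyclic, the nontrivial character η ∘ det of T must be χ.
  have hodd : 2 ∣ Nat.card Fˣ := by
    have h1 : (χ t) ^ (Nat.card F + 1) = 1 := by
      rw [← hT.card, ← map_pow, pow_card_eq_one', map_one]
    rw [h] at h1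
    have h2 : Even (Nat.card F + 1) := by
      by_contra h3
      rw [Nat.not_even_iff_odd] at h3
      rw [h3.neg_one_pow] at h1
      have := congr_arg (fun u : ℂˣ => (u : ℂ)) h1
      norm_num at this
    rw [Nat.card_units]
    obtain ⟨r, hr⟩ := h2
    exact ⟨r - 1, by omega⟩
  have := Fact.mk Nat.prime_two
  rw [← card_dual] at hodd
  obtain ⟨η, hη⟩ := exists_prime_orderOf_dvd_card' 2 hodd
  have h2 : η ^ 2 = 1 := hη ▸ pow_orderOf_eq_one η
  have h3 : η ≠ 1 := fun h => by simp [h] at hη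
  have h4 := detCharRes_nonsplit_ne_one hT h2 h3
  refine ⟨η, h2, hext _ ?_⟩
  have h5 : detCharRes T η h2 * detCharRes T η h2 = 1 := by
    ext s
    exact congr_arg _ (detChar_mul_self η h2 s)
  rcases hsq h5 with h6 | h6
  · refine absurd ?_ h4
    ext s
    obtain ⟨n, rfl⟩ := Subgroup.mem_zpowers_iff.1 (ht s)
    rw [map_zpow, map_zpow, h6]; rfl
  · rw [h, h6]

end QuadraticCharacters

/-! ### Consequences of genericity. -/

section GenericMultiplicity

variable {F : Type*} [Field F] {V : Type*} [AddCommGroup V] [Module ℂ V]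
  {π : Representation ℂ PGL(2, F) V}

/-- The witness is the multiplicity of ψ. Since π takes a single value on the nontrivial elements of
U and ψ sums to zero, that multiplicity is (π(1) - π(u))/q. -/
lemma IsGeneric.exists_multiplicity [Finite F] [FiniteDimensional ℂ V] (h : IsGeneric π) :
    ∃ m : ℕ, 1 ≤ m ∧ π.character 1 = m * Nat.card F + π.character (unip 1) := by
  classical
  have := Fintype.ofFinite F
  obtain ⟨ψ, hψ, v, hv, hx⟩ := h
  have hψ0 : ∀ x, ψ (-x) * ψ x = 1 := fun x => by
    rw [← AddChar.map_add_eq_mul, neg_add_cancel, AddChar.map_zero_eq_one]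
  let ρ : Representation ℂ (Multiplicative F) V :=
    { toFun := fun x => ψ (-x.toAdd) • π (unip x.toAdd)
      map_one' := by simp [unip_zero]
      map_mul' := fun x y => by
        rw [toAdd_mul, neg_add, AddChar.map_add_eq_mul, unip_add, map_mul, smul_mul_smul_comm] }
  have hchar : ∀ x, ρ.character x = ψ (-x.toAdd) * π.character (unip x.toAdd) := fun x => by
    change LinearMap.trace ℂ V (ψ (-x.toAdd) • π (unip x.toAdd)) = _
    rw [map_smul]
    rfl
  have hinv : v ∈ ρ.invariants := by
    rw [mem_invariants]
    intro x
    change ψ (-x.toAdd) • π (unip x.toAdd) v = v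
    rw [hx, smul_smul, hψ0, one_smul]
  have hpos : 1 ≤ Module.finrank ℂ ρ.invariants := by
    have : Nontrivial ρ.invariants := ⟨⟨v, hinv⟩, 0, fun h => hv (congr_arg Subtype.val h)⟩
    exact Module.finrank_pos
  refine ⟨_, hpos, ?_⟩
  have h1 := average_character ρ
  have h2 : ∑ x, ρ.character x = π.character 1 - π.character (unip 1) := by
    have h3 : ∑ x : Multiplicative F, ρ.character x =
        ∑ x : F, ψ (-x) * π.character (unip x) :=
      (_root_.Equiv.sum_comp Multiplicative.ofAdd ρ.character).symm.trans
        (Finset.sum_congr rfl fun x _ => hchar _)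
    have h4 : ∑ x : F, ψ (-x) = 0 := by
      refine (_root_.Equiv.sum_comp (Equiv.neg F) ψ).trans ?_
      exact AddChar.sum_eq_zero_of_ne_one hψ
    have h5 : ∀ x : F, ψ (-x) * π.character (unip x) = ψ (-x) * π.character (unip 1) +
        if x = 0 then π.character 1 - π.character (unip 1) else 0 := by
      intro x
      split_ifs with hx0
      · subst hx0
        rw [neg_zero, AddChar.map_zero_eq_one, unip_zero]
        ring
      · rw [apply_unip_of_ne_zero (fun g h => char_conj π g h) hx0, add_zero]
    rw [h3, Finset.sum_congr rfl fun x _ => h5 x, Finset.sum_add_distrib, ← Finset.sum_mul, h4]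
    simp
  rw [h2] at h1
  have hcard : Nat.card (Multiplicative F) = Nat.card F := rfl
  rw [hcard] at h1
  rw [← h1]
  field_simp [card_ne_zero (F := F)]
  ring

/-- A nonzero map would be injective by irreducibility, but η ∘ det is trivial on U and so cannot
contain the ψ-eigenvector. -/
lemma IsGeneric.intertwiningMap_eq_zero [π.IsIrreducible] (h : IsGeneric π) (η : Fˣ →* ℂˣ)
    (hη : η ^ 2 = 1) (f : IntertwiningMap π (charRep (detChar η hη))) : f = 0 := by
  obtain ⟨ψ, hψ, v, hv, hx⟩ := h
  refine (IsIrreducible.injective_or_eq_zero f).resolve_left fun hf => hψ ?_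
  ext x
  have h1 := f.isIntertwining _ _ (unip x) v
  have h2 : charRep (detChar η hη) (unip x) (f v) = f v := by
    simp [charRep, detChar_unip]
  rw [h2, hx, map_smul, smul_eq_mul] at h1
  have h3 : f v ≠ 0 := fun h0 => hv (hf (by rw [h0, map_zero]))
  rw [AddChar.one_apply]
  exact mul_right_cancel₀ h3 (h1.trans (one_mul _).symm)

end GenericMultiplicity

/-! ### Functions whose Fourier coefficients are 0 or 1. -/

section Indicator

/-- For integers x² - x ≥ 0, with equality only at 0 and 1. The total of these terms is 2 - 2m ≤ 0,
so every one vanishes. -/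
lemma zero_or_one_of_sums {ι ι' : Type*} [Fintype ι] [Fintype ι'] {k : ι → ℤ} {l : ι' → ℤ} {m : ℤ}
    (hm : 1 ≤ m) (h1 : ∑ i, k i + ∑ i, l i = 2 * m)
    (h2 : ∑ i, k i * k i + ∑ i, l i * l i = 2) :
    m = 1 ∧ (∀ i, k i = 0 ∨ k i = 1) ∧ ∀ i, l i = 0 ∨ l i = 1 := by
  have hnn : ∀ x : ℤ, 0 ≤ x * x - x := fun x => by
    rcases le_or_gt x 0 with h | h
    · nlinarith
    · nlinarith
  have hk : 0 ≤ ∑ i, (k i * k i - k i) := Finset.sum_nonneg fun i _ => hnn _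
  have hl : 0 ≤ ∑ i, (l i * l i - l i) := Finset.sum_nonneg fun i _ => hnn _
  have hk' := Finset.sum_sub_distrib (s := Finset.univ) (fun i => k i * k i) k
  have hl' := Finset.sum_sub_distrib (s := Finset.univ) (fun i => l i * l i) l
  have hk0 : ∑ i, (k i * k i - k i) = 0 := by linarith
  have hl0 : ∑ i, (l i * l i - l i) = 0 := by linarith
  have h01 : ∀ x : ℤ, x * x - x = 0 → x = 0 ∨ x = 1 := fun x hx => by
    have : x * (x - 1) = 0 := by linarith
    rcases mul_eq_zero.1 this with h | h
    · exact Or.inl h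
    · exact Or.inr (by linarith)
  refine ⟨by linarith, fun i => h01 _ ?_, fun i => h01 _ ?_⟩
  · exact (Finset.sum_eq_zero_iff_of_nonneg fun i _ => hnn _).1 hk0 i (Finset.mem_univ i)
  · exact (Finset.sum_eq_zero_iff_of_nonneg fun i _ => hnn _).1 hl0 i (Finset.mem_univ i)

variable {A : Type*} [Group A] [Fintype A] [IsMulCommutative A] {f : A → ℂ} {k : (A →* ℂˣ) → ℤ}

lemma eq_sum_of_fourierCoeff (hk : ∀ χ, fourierCoeff f χ = k χ) (h01 : ∀ χ, k χ = 0 ∨ k χ = 1)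
    (a : A) : f a = ∑ χ with k χ = 1, (χ a : ℂ) := by
  rw [← sum_fourierCoeff_mul f a, Finset.sum_filter]
  refine Finset.sum_congr rfl fun χ _ => ?_
  rw [hk]
  rcases h01 χ with h | h <;> simp [h]

lemma card_eq_of_fourierCoeff (hk : ∀ χ, fourierCoeff f χ = k χ) (h01 : ∀ χ, k χ = 0 ∨ k χ = 1)
    {n : ℕ} (hn : f 1 = n) : (Finset.univ.filter fun χ => k χ = 1).card = n := by
  have := eq_sum_of_fourierCoeff hk h01 1
  rw [hn] at this
  simp at this
  exact_mod_cast this.symm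

lemma eq_zero_of_fourierCoeff (hk : ∀ χ, fourierCoeff f χ = k χ) (h01 : ∀ χ, k χ = 0 ∨ k χ = 1)
    (hn : f 1 = 0) (a : A) : f a = 0 := by
  have h := card_eq_of_fourierCoeff (n := 0) hk h01 (by rw [hn, Nat.cast_zero])
  rw [eq_sum_of_fourierCoeff hk h01, Finset.card_eq_zero.1 h, Finset.sum_empty]

lemma apply_inv_of_fourierCoeff (hf : ∀ a, f a⁻¹ = f a) (hk : ∀ χ, fourierCoeff f χ = k χ)
    (χ : A →* ℂˣ) : k χ⁻¹ = k χ := by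
  have := fourierCoeff_inv f hf χ
  rw [hk, hk] at this
  exact_mod_cast this

lemma eq_hom_of_fourierCoeff (hf : ∀ a, f a⁻¹ = f a) (hk : ∀ χ, fourierCoeff f χ = k χ)
    (h01 : ∀ χ, k χ = 0 ∨ k χ = 1) (hn : f 1 = 1) :
    ∃ χ : A →* ℂˣ, χ * χ = 1 ∧ k χ = 1 ∧ (∀ χ', k χ' = 1 → χ' = χ) ∧ ∀ a, f a = χ a := by
  have h := card_eq_of_fourierCoeff (n := 1) hk h01 (by rw [hn, Nat.cast_one])
  obtain ⟨χ, hχ⟩ := Finset.card_eq_one.1 h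
  have hmem : ∀ χ', k χ' = 1 ↔ χ' = χ := fun χ' => by
    simpa using congr_arg (fun s => χ' ∈ s) hχ
  have h1 := (hmem χ).2 rfl
  refine ⟨χ, ?_, h1, fun χ' => (hmem χ').1, fun a => ?_⟩
  · have := (hmem χ⁻¹).1 (by rw [apply_inv_of_fourierCoeff hf hk, h1])
    nth_rw 1 [← this]
    exact inv_mul_cancel χ
  · rw [eq_sum_of_fourierCoeff hk h01, hχ, Finset.sum_singleton]

/-- The two characters occurring form a set stable under inversion. `hquad` excludes that each is
its own inverse, so they are exchanged. -/
lemma eq_hom_add_inv_of_fourierCoeff (hf : ∀ a, f a⁻¹ = f a) (hk : ∀ χ, fourierCoeff f χ = k χ)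
    (h01 : ∀ χ, k χ = 0 ∨ k χ = 1) (hn : f 1 = 2) (hquad : ∀ χ, χ * χ = 1 → k χ ≠ 1) :
    ∃ χ : A →* ℂˣ, χ * χ ≠ 1 ∧ ∀ a, f a = χ a + χ a⁻¹ := by
  classical
  have h := card_eq_of_fourierCoeff (n := 2) hk h01 (by rw [hn, Nat.cast_ofNat])
  obtain ⟨χ, χ', hne, hχ⟩ := Finset.card_eq_two.1 h
  have hmem : ∀ ψ, k ψ = 1 ↔ ψ = χ ∨ ψ = χ' := fun ψ => by
    simpa using congr_arg (fun s => ψ ∈ s) hχ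
  have h1 := (hmem χ).2 (Or.inl rfl)
  have h2 : χ * χ ≠ 1 := fun h => hquad χ h h1
  have h3 : χ⁻¹ = χ' := by
    refine ((hmem χ⁻¹).1 (by rw [apply_inv_of_fourierCoeff hf hk, h1])).resolve_left fun h => h2 ?_
    nth_rw 1 [← h]
    exact inv_mul_cancel χ
  refine ⟨χ, h2, fun a => ?_⟩
  rw [eq_sum_of_fourierCoeff hk h01, hχ, Finset.sum_pair hne, ← h3]
  simp

end Indicator

/-! ### Classification of the restrictions to the tori. -/

section Classification

variable {F : Type*} [Field F] [Finite F] {T : Subgroup PGL(2, F)} {V : Type*} [AddCommGroup V]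
  [Module ℂ V] [FiniteDimensional ℂ V] (π : Representation ℂ PGL(2, F) V)

omit [FiniteDimensional ℂ V] in
lemma IsDihedralTorus.character_inv {G : Type*} [Group G] {H : Subgroup G} {w : G}
    (hH : IsDihedralTorus H w) (ρ : Representation ℂ G V) {h : G} (hh : h ∈ H) :
    ρ.character h⁻¹ = ρ.character h := by
  rw [← hH.conj h hh]
  nth_rw 2 [← hH.w_inv]
  exact char_conj ρ h w

/-- The possible restrictions of the character of an irreducible generic representation to the
tori, for principal series, Steinberg and cuspidal representations respectively. -/
def GenericType (T : Subgroup PGL(2, F)) (a : ℂ) (k : splitTorus F → ℂ) (l : T → ℂ) : Prop :=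
  (∃ χ : splitTorus F →* ℂˣ, χ * χ ≠ 1 ∧ a = 1 ∧ (∀ s, k s = χ s + χ s⁻¹) ∧ ∀ t, l t = 0) ∨
  (∃ (η : Fˣ →* ℂˣ) (hη : η ^ 2 = 1), a = 0 ∧ (∀ s, k s = detCharRes (splitTorus F) η hη s) ∧
    ∀ t, l t = detCharRes T η hη t) ∨
  (∃ χ : T →* ℂˣ, χ * χ ≠ 1 ∧ a = -1 ∧ (∀ s, k s = 0) ∧ ∀ t, l t = χ t + χ t⁻¹)

theorem exists_genericType (hT : IsNonsplitTorus T) (hirr : π.IsIrreducible)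
    (hgen : IsGeneric π) :
    ∃ a k l, TorusData T π.character 1 a k l ∧ GenericType T a k l := by
  classical
  have := Fintype.ofFinite PGL(2, F)
  have := Fintype.ofFinite (splitTorus F)
  have := Fintype.ofFinite T
  obtain ⟨w, hw⟩ := hT.exists_isDihedralTorus
  have hS := isDihedralTorus_splitTorus (F := F)
  have := hS.isMulCommutative
  have := hw.isMulCommutative
  obtain ⟨m, hm, hm1⟩ := hgen.exists_multiplicity
  have hdata := TorusData.of_classFunction (T := T) (fun g h => char_conj π g h) hm1 rfl
  set a := π.character (unip 1)
  set k : splitTorus F → ℂ := fun s => π.character s - if s = 1 then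
    (m : ℂ) * (Nat.card F - 1) else 0 with hkdef
  set l : T → ℂ := fun t => (if t = 1 then (m : ℂ) * (Nat.card F + 1) else 0) - π.character t
    with hldef
  have hkinv : ∀ s, k s⁻¹ = k s := by
    intro s
    have h1 : (s⁻¹ = 1) = (s = 1) := propext _root_.inv_eq_one
    have h2 := hS.character_inv π s.2
    simp only [hkdef, h1, Subgroup.coe_inv, h2]
  have hlinv : ∀ s, l s⁻¹ = l s := by
    intro s
    have h1 : (s⁻¹ = 1) = (s = 1) := propext _root_.inv_eq_one
    have h2 := hw.character_inv π s.2
    simp only [hldef, h1, Subgroup.coe_inv, h2]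
  have hkint : ∀ χ, ∃ n : ℤ, fourierCoeff k χ = n := by
    intro χ
    obtain ⟨n, hn⟩ := fourierCoeff_character (res π (splitTorus F)) χ
    refine ⟨n - m, ?_⟩
    have h1 := fourierCoeff_single (A := splitTorus F) (m : ℂ) χ
    have h2 : k = (res π (splitTorus F)).character -
        fun s => if s = 1 then (Nat.card (splitTorus F) : ℂ) * m else 0 := by
      ext s
      rw [card_splitTorus_complex, mul_comm _ (m : ℂ)]
      rfl
    rw [h2, fourierCoeff_sub, hn, h1]
    push_cast
    ring
  have hlint : ∀ χ, ∃ n : ℤ, fourierCoeff l χ = n := by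
    intro χ
    obtain ⟨n, hn⟩ := fourierCoeff_character (res π T) χ
    refine ⟨m - n, ?_⟩
    have h1 := fourierCoeff_single (A := T) (m : ℂ) χ
    have h2 : l = (fun s => if s = 1 then (Nat.card T : ℂ) * m else 0) -
        (res π T).character := by
      ext s
      rw [hT.card_complex, mul_comm _ (m : ℂ)]
      rfl
    rw [h2, fourierCoeff_sub, hn, h1]
    push_cast
    ring
  choose kc hkc using hkint
  choose lc hlc using hlint
  have hksum : k 1 = ((∑ χ, kc χ : ℤ) : ℂ) := by
    rw [← sum_fourierCoeff_mul k 1]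
    push_cast
    exact Finset.sum_congr rfl fun χ _ => by simp [hkc]
  have hlsum : l 1 = ((∑ χ, lc χ : ℤ) : ℂ) := by
    rw [← sum_fourierCoeff_mul l 1]
    push_cast
    exact Finset.sum_congr rfl fun χ _ => by simp [hlc]
  have hsum : ∑ χ, kc χ + ∑ χ, lc χ = 2 * (m : ℤ) := by
    have h := congr_arg₂ (· + ·) hdata.k_one hdata.l_one
    simp only [hksum, hlsum] at h
    have h' : (((∑ χ, kc χ + ∑ χ, lc χ : ℤ)) : ℂ) = ((2 * (m : ℤ) : ℤ) : ℂ) := by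
      rw [Int.cast_add, h]
      push_cast
      ring
    exact_mod_cast h'
  -- Schur's lemma for π, read through `average_mul` and Plancherel on both tori.
  have hsq : ∑ χ, kc χ * kc χ + ∑ χ, lc χ * lc χ = 2 := by
    have h1 := hdata.average_mul hT hdata.comp_inv
    have h2 : (Nat.card PGL(2, F) : ℂ)⁻¹ * ∑ g, π.character g * π.character g⁻¹ = 1 := by
      have := average_character_mul π π
      rw [this, IsIrreducible.finrank_intertwiningMap_self π, Nat.cast_one]
    rw [h2, average_mul_inv, average_mul_inv] at h1
    simp only [hkc, hlc] at h1
    have h3 : ((∑ χ, kc χ * kc χ + ∑ χ, lc χ * lc χ : ℤ) : ℂ) = ((2 : ℤ) : ℂ) := by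
      push_cast
      linear_combination -2 * h1
    exact_mod_cast h3
  -- The character η ∘ det has l equal to minus its restriction to T, so its orthogonality to π
  -- equates the two coefficients.
  have heta : ∀ (η : Fˣ →* ℂˣ) (hη : η ^ 2 = 1),
      kc (detCharRes (splitTorus F) η hη) = lc (detCharRes T η hη) := by
    intro η hη
    have h1 := (torusData_detChar T η hη).average_mul hT hdata.comp_inv
    have h2 : (Nat.card PGL(2, F) : ℂ)⁻¹ *
        ∑ g, (detChar η hη g : ℂ) * π.character g⁻¹ = 0 := by
      have h3 := average_character_mul π (charRep (detChar η hη))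
      simp only [character_charRep] at h3
      rw [h3]
      have : Subsingleton (IntertwiningMap π (charRep (detChar η hη))) :=
        ⟨fun f g => by rw [hgen.intertwiningMap_eq_zero η hη f,
          hgen.intertwiningMap_eq_zero η hη g]⟩
      rw [Module.finrank_zero_of_subsingleton, Nat.cast_zero]
    rw [h2, average_mul_inv, average_mul_inv] at h1
    have h4 : ∀ χ, fourierCoeff (fun t : T => -(detCharRes T η hη t : ℂ)) χ =
        if detCharRes T η hη = χ then -1 else 0 := by
      intro χ
      have := fourierCoeff_neg (fun t : T => (detCharRes T η hη t : ℂ)) χ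
      rw [fourierCoeff_hom] at this
      refine Eq.trans this ?_
      split_ifs <;> simp
    simp only [fourierCoeff_hom, h4, ite_mul, one_mul, zero_mul, neg_mul, Finset.sum_ite_eq,
      Finset.mem_univ, if_true, hkc, hlc] at h1
    have h5 : (kc (detCharRes (splitTorus F) η hη) : ℂ) = lc (detCharRes T η hη) := by
      linear_combination -2 * h1
    exact_mod_cast h5
  obtain ⟨hm', hk01, hl01⟩ := zero_or_one_of_sums (by exact_mod_cast hm) hsum hsq
  have hm' : m = 1 := by exact_mod_cast hm'
  have hk1 := hdata.k_one
  have hl1 := hdata.l_one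
  have hdata' : TorusData T π.character 1 a k l := by
    convert hdata
    rw [hm', Nat.cast_one]
  rw [hm', Nat.cast_one] at hk1 hl1
  refine ⟨a, k, l, hdata', ?_⟩
  have hk0 : 0 ≤ ∑ χ, kc χ := Finset.sum_nonneg fun χ _ => by
    rcases hk01 χ with h | h <;> simp [h]
  have hl0 : 0 ≤ ∑ χ, lc χ := Finset.sum_nonneg fun χ _ => by
    rcases hl01 χ with h | h <;> simp [h]
  rw [hm'] at hsum
  have hcases : (∑ χ, kc χ = 2 ∧ ∑ χ, lc χ = 0) ∨ (∑ χ, kc χ = 1 ∧ ∑ χ, lc χ = 1) ∨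
    (∑ χ, kc χ = 0 ∧ ∑ χ, lc χ = 2) := by
    push_cast at hsum
    omega
  rcases hcases with ⟨h1, h2⟩ | ⟨h1, h2⟩ | ⟨h1, h2⟩
  · rw [h1] at hksum
    rw [h2] at hlsum
    push_cast at hksum hlsum
    have hlz : ∀ χ, lc χ = 0 := fun χ => by
      refine (Finset.sum_eq_zero_iff_of_nonneg fun χ _ => ?_).1 h2 χ (Finset.mem_univ χ)
      rcases hl01 χ with h | h <;> simp [h]
    -- A quadratic character in k is some η ∘ det, hence would also occur in l, which is zero here.
    obtain ⟨χ, hχ, hkχ⟩ := eq_hom_add_inv_of_fourierCoeff hkinv hkc hk01 hksum fun χ hχ => by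
      obtain ⟨η, hη, rfl⟩ := exists_eq_detCharRes_split χ hχ
      rw [heta, hlz]
      exact zero_ne_one
    exact Or.inl ⟨χ, hχ, by linear_combination hksum - hk1, hkχ,
      eq_zero_of_fourierCoeff hlc hl01 hlsum⟩
  · rw [h1] at hksum
    rw [h2] at hlsum
    push_cast at hksum hlsum
    obtain ⟨χ, hχ, hkχ, -, hχk⟩ := eq_hom_of_fourierCoeff hkinv hkc hk01 hksum
    obtain ⟨χ', -, -, huniq, hχl⟩ := eq_hom_of_fourierCoeff hlinv hlc hl01 hlsum
    obtain ⟨η, hη, rfl⟩ := exists_eq_detCharRes_split χ hχ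
    have := huniq (detCharRes T η hη) (by rw [← heta, hkχ])
    subst this
    exact Or.inr (Or.inl ⟨η, hη, by linear_combination hksum - hk1, hχk, hχl⟩)
  · rw [h1] at hksum
    rw [h2] at hlsum
    push_cast at hksum hlsum
    have hkz : ∀ χ, kc χ = 0 := fun χ => by
      refine (Finset.sum_eq_zero_iff_of_nonneg fun χ _ => ?_).1 h1 χ (Finset.mem_univ χ)
      rcases hk01 χ with h | h <;> simp [h]
    obtain ⟨χ, hχ, hlχ⟩ := eq_hom_add_inv_of_fourierCoeff hlinv hlc hl01 hlsum fun χ hχ => by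
      obtain ⟨η, hη, rfl⟩ := exists_eq_detCharRes_nonsplit hT χ hχ
      rw [← heta, hkz]
      exact zero_ne_one
    exact Or.inr (Or.inr ⟨χ, hχ, by linear_combination hksum - hk1,
      eq_zero_of_fourierCoeff hkc hk01 hksum, hlχ⟩)

end Classification

/-! ### The character of an augmentation kernel. -/

section AugmentationKernel

/-- The fixed vector e spans a trivial complement of the kernel of φ. -/
lemma character_ker {G V : Type*} [Group G] [AddCommGroup V] [Module ℂ V] [FiniteDimensional ℂ V]
    (ρ : Representation ℂ G V) (φ : V →ₗ[ℂ] ℂ) (hφ : ∀ g v, φ (ρ g v) = φ v)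
    (hker : ∀ g, LinearMap.ker φ ≤ (LinearMap.ker φ).comap (ρ g)) {e : V}
    (he : ∀ g, ρ g e = e) (h1 : φ e = 1) (g : G) :
    (ρ.subrepresentation _ hker).character g = ρ.character g - 1 := by
  let E : V ≃ₗ[ℂ] LinearMap.ker φ × ℂ :=
    { toFun := fun v => (⟨v - φ v • e, by simp [h1]⟩, φ v)
      map_add' := fun v w => by
        refine Prod.ext (Subtype.ext ?_) (map_add φ v w)
        simp only [map_add, add_smul, Prod.fst_add, Submodule.coe_add]
        abel
      map_smul' := fun c v => by
        refine Prod.ext (Subtype.ext ?_) (map_smul φ c v)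
        simp [smul_sub, mul_smul]
      invFun := fun x => x.1 + x.2 • e
      left_inv := fun v => by simp
      right_inv := fun x => by
        have hx : φ x.1 = 0 := x.1.2
        refine Prod.ext (Subtype.ext ?_) ?_ <;> simp [hx, h1] }
  have hE : Nonempty (ρ.Equiv ((ρ.subrepresentation _ hker).prod (charRep (1 : G →* ℂˣ)))) := by
    refine ⟨Representation.Equiv.mk E fun g => LinearMap.ext fun v => ?_⟩
    refine Prod.ext (Subtype.ext ?_) ?_
    · change ρ g v - φ (ρ g v) • e = ρ g (v - φ v • e)
      rw [hφ, map_sub, map_smul, he]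
    · change φ (ρ g v) = charRep (1 : G →* ℂˣ) g (φ v)
      rw [hφ]
      simp [charRep]
  obtain ⟨e'⟩ := hE
  rw [char_iso e', character_prod, Pi.add_apply, character_charRep]
  simp

lemma augmentation_single {X : Type*} (x : X) (r : ℂ) :
    augmentation X (MonoidAlgebra.single x r) = r := by
  simp [augmentation]

lemma character_augmentation_ker {G X : Type*} [Group G] [MulAction G X] [Finite X] [Nonempty X]
    (hker : ∀ g, LinearMap.ker (augmentation X) ≤
      (LinearMap.ker (augmentation X)).comap (ofMulAction ℂ G X g)) (g : G) :
    ((ofMulAction ℂ G X).subrepresentation _ hker).character g =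
      Nat.card (MulAction.fixedBy X g) - 1 := by
  have := Fintype.ofFinite X
  rw [character_ker (ofMulAction ℂ G X) (augmentation X) (fun g f => augmentation_ofMulAction g f)
    hker (e := (Fintype.card X : ℂ)⁻¹ • ∑ x : X, MonoidAlgebra.single x (1 : ℂ)) (fun g => ?_) ?_,
    character_ofMulAction]
  · rw [map_smul, map_sum]
    simp [augmentation_single]
  · rw [map_smul, map_sum]
    simp only [ofMulAction_single]
    congr 1
    exact _root_.Equiv.sum_comp (MulAction.toPerm g) fun x => MonoidAlgebra.single x (1 : ℂ)

end AugmentationKernel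

/-! ### The Steinberg representation and its twists. -/

section Steinberg

variable {F : Type*} [Field F] {T : Subgroup PGL(2, F)}

lemma mem_fixedBy_borel {g h : PGL(2, F)} :
    (h : PGL(2, F) ⧸ borel F) ∈ MulAction.fixedBy (PGL(2, F) ⧸ borel F) g ↔
      h⁻¹ * g * h ∈ borel F := by
  rw [MulAction.mem_fixedBy, MulAction.Quotient.smul_coe, eq_comm, QuotientGroup.eq, smul_eq_mul,
    mul_assoc]

lemma weyl_notMem_borel : weyl F ∉ borel F := by
  rw [weyl, mk_mem_borel]
  simp

lemma fixedBy_unip :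
    MulAction.fixedBy (PGL(2, F) ⧸ borel F) (unip (1 : F)) = {((1 : PGL(2, F)) : PGL(2, F) ⧸ _)} := by
  ext x
  induction x using QuotientGroup.induction_on with
  | H g =>
  have h1 : unip (1 : F) ≠ 1 := fun h => one_ne_zero (unip_injective (h.trans unip_zero.symm))
  rw [mem_fixedBy_borel, borel_conj_mem_iff_of_unipotent ⟨1, rfl⟩ h1, Set.mem_singleton_iff,
    eq_comm, QuotientGroup.eq, inv_one, one_mul]

lemma fixedBy_split {s : PGL(2, F)} (hs : s ∈ splitTorus F) (h1 : s ≠ 1) :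
    MulAction.fixedBy (PGL(2, F) ⧸ borel F) s =
      {((1 : PGL(2, F)) : PGL(2, F) ⧸ _), ((weyl F : PGL(2, F)) : PGL(2, F) ⧸ _)} := by
  ext x
  induction x using QuotientGroup.induction_on with
  | H g =>
  rw [mem_fixedBy_borel, borel_conj_mem_iff_of_split hs h1, Set.mem_insert_iff,
    Set.mem_singleton_iff, eq_comm, QuotientGroup.eq, inv_one, one_mul,
    eq_comm (a := (g : PGL(2, F) ⧸ borel F)), QuotientGroup.eq, isDihedralTorus_splitTorus.w_inv]

variable [Finite F]

lemma card_quotient_borel : Nat.card (PGL(2, F) ⧸ borel F) = Nat.card F + 1 := by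
  have h := (borel F).card_eq_card_quotient_mul_card_subgroup
  have h2 := two_le_card (F := F)
  rw [card_borel] at h
  have h3 := congr_arg (fun n : ℕ => (n : ℂ)) h
  simp only [Nat.cast_mul, card_PGL_complex] at h3
  rw [Nat.cast_sub (by omega), Nat.cast_one] at h3
  have h4 := mul_ne_zero (card_ne_zero (F := F)) (card_sub_one_ne_zero (F := F))
  have h5 : (Nat.card (PGL(2, F) ⧸ borel F) : ℂ) = Nat.card F + 1 :=
    mul_right_cancel₀ h4 (by rw [← h3]; ring)
  exact_mod_cast h5

lemma steinberg_character (g : PGL(2, F)) : (steinberg F).character g =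
    Nat.card (MulAction.fixedBy (PGL(2, F) ⧸ borel F) g) - 1 :=
  character_augmentation_ker _ g

lemma exists_equiv_fin_tprod {G V W : Type*} [Group G] [AddCommGroup V] [Module ℂ V]
    [FiniteDimensional ℂ V] [AddCommGroup W] [Module ℂ W] [FiniteDimensional ℂ W]
    (ρ : Representation ℂ G V) (σ : Representation ℂ G W) :
    ∃ (n : ℕ) (τ : Representation ℂ G (Fin n → ℂ)),
      Nonempty ((ρ.tprod σ).Equiv τ) ∧ τ.character = ρ.character * σ.character := by
  obtain ⟨n, τ, ⟨e⟩⟩ := exists_equiv_fin (V := V ⊗[ℂ] W) (ρ.tprod σ)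
  exact ⟨n, τ, ⟨e⟩, by rw [← char_tensor]; exact (char_iso e).symm⟩

/-- A model of the twist `St ⊗ (η ∘ det)` on a coordinate space. -/
lemma exists_equiv_steinbergTwist (hT : IsNonsplitTorus T) (η : Fˣ →* ℂˣ) (hη : η ^ 2 = 1) :
    ∃ (n : ℕ) (ρ : Representation ℂ PGL(2, F) (Fin n → ℂ)),
      Nonempty (((steinberg F).tprod (charRep (detChar η hη))).Equiv ρ) ∧
      TorusData T ρ.character 1 0 (fun s => detCharRes (splitTorus F) η hη s)
        (fun t => detCharRes T η hη t) := by
  obtain ⟨n, ρ, e, hρ⟩ := exists_equiv_fin_tprod (steinberg F) (charRep (detChar η hη))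
  have hchar : ∀ g, ρ.character g =
      (Nat.card (MulAction.fixedBy (PGL(2, F) ⧸ borel F) g) - 1) * detChar η hη g := fun g => by
    rw [hρ, Pi.mul_apply, steinberg_character, character_charRep]
  refine ⟨n, ρ, e, ⟨fun g h => char_conj _ g h, ?_, ?_, fun s => ?_, fun t => ?_⟩⟩
  · rw [hchar, MulAction.fixedBy_one_eq_univ, Nat.card_univ, card_quotient_borel]
    simp
  · rw [hchar, fixedBy_unip]
    simp
  · rw [hchar, detCharRes_apply]
    split_ifs with h
    · subst h
      rw [Subgroup.coe_one, MulAction.fixedBy_one_eq_univ, Nat.card_univ, card_quotient_borel]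
      simp
    · have h1 : (s : PGL(2, F)) ≠ 1 := fun h' => h (Subtype.ext h')
      rw [fixedBy_split s.2 h1, Nat.card_coe_set_eq, Set.ncard_pair]
      · push_cast
        ring
      · rw [ne_eq, QuotientGroup.eq, inv_one, one_mul]
        exact weyl_notMem_borel
  · rw [hchar, detCharRes_apply]
    split_ifs with h
    · subst h
      rw [Subgroup.coe_one, MulAction.fixedBy_one_eq_univ, Nat.card_univ, card_quotient_borel]
      simp
    · have h1 : (t : PGL(2, F)) ≠ 1 := fun h' => h (Subtype.ext h')
      have h2 : MulAction.fixedBy (PGL(2, F) ⧸ borel F) (t : PGL(2, F)) = ∅ := by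
        ext x
        induction x using QuotientGroup.induction_on with
        | H g =>
          rw [mem_fixedBy_borel]
          simp [hT.conj_notMem_borel t.2 h1]
      rw [h2]
      simp

variable {V : Type*} [AddCommGroup V] [Module ℂ V] {π : Representation ℂ PGL(2, F) V}
  {a : ℂ} {k : splitTorus F → ℂ} {l : T → ℂ}

omit [Finite F] in
lemma TorusData.finrank_eq [FiniteDimensional ℂ V] (h : TorusData T π.character 1 0 k l) :
    Module.finrank ℂ V = Nat.card F := by
  have := h.one
  rw [char_one, one_mul, add_zero] at this
  exact_mod_cast this

/-- The pairing with the twist is (1 + 1)/2 = 1, so there is a nonzero map. It is injective as π is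
irreducible, and both sides have dimension q; irreducibility of the Steinberg representation is not
needed. -/
lemma TorusData.isSteinbergTwist [FiniteDimensional ℂ V] (hT : IsNonsplitTorus T)
    [π.IsIrreducible] {η : Fˣ →* ℂˣ} {hη : η ^ 2 = 1}
    (h : TorusData T π.character 1 0 (fun s => detCharRes (splitTorus F) η hη s)
      (fun t => detCharRes T η hη t)) : IsSteinbergTwist π η hη := by
  have := Fintype.ofFinite PGL(2, F)
  have := Fintype.ofFinite (splitTorus F)
  have := Fintype.ofFinite T
  obtain ⟨n, ρ, ⟨e⟩, h2⟩ := exists_equiv_steinbergTwist hT η hη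
  have h1 := average_character_mul π ρ
  have h3 : ∀ H : Subgroup PGL(2, F), ∀ [Fintype H], (Nat.card H : ℂ)⁻¹ *
      ∑ x : H, (detCharRes H η hη x : ℂ) * detCharRes H η hη x⁻¹ = 1 := by
    intro H _
    simp only [map_inv, Units.mul_inv, Finset.sum_const, Finset.card_univ, nsmul_eq_mul, mul_one,
      Nat.card_eq_fintype_card]
    exact inv_mul_cancel₀ (by simp [Fintype.card_ne_zero])
  rw [h2.average_mul hT h.comp_inv, h3, h3] at h1
  have h4 : ∃ f : IntertwiningMap π ρ, f ≠ 0 := by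
    by_contra! h5
    have : Subsingleton (IntertwiningMap π ρ) := ⟨fun f g => by rw [h5 f, h5 g]⟩
    rw [Module.finrank_zero_of_subsingleton] at h1
    norm_num at h1
  obtain ⟨f, hf⟩ := h4
  have hinj := (IsIrreducible.injective_or_eq_zero f).resolve_right hf
  have hsurj : Function.Surjective f.toLinearMap :=
    (LinearMap.injective_iff_surjective_of_finrank_eq_finrank
      (h.finrank_eq.trans h2.finrank_eq.symm)).1 hinj
  exact ⟨(Representation.Equiv.mk (LinearEquiv.ofBijective f.toLinearMap ⟨hinj, hsurj⟩)
    f.isIntertwining').trans e.symm⟩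

lemma TorusData.eq_zero_of_isSteinbergTwist (hT : IsNonsplitTorus T)
    (h : TorusData T π.character 1 a k l) {η : Fˣ →* ℂˣ} {hη : η ^ 2 = 1}
    (h' : IsSteinbergTwist π η hη) :
    a = 0 ∧ ∀ s, k s = detCharRes (splitTorus F) η hη s := by
  obtain ⟨e⟩ := h'
  obtain ⟨n, ρ, ⟨e'⟩, h2⟩ := exists_equiv_steinbergTwist hT η hη
  rw [← char_iso (e.trans e')] at h2
  have ha : a = 0 := by rw [← h.unip, h2.unip]
  refine ⟨ha, fun s => ?_⟩
  have h3 := h.split s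
  rw [h2.split] at h3
  linear_combination -h3

end Steinberg

/-! ### Triple multiplicities for normalizers of tori. -/

section TripleMultiplicity

lemma tripleMult_eq_average {G : Type*} [Group G] [Fintype G] {W : Fin 3 → Type*}
    [∀ i, AddCommGroup (W i)] [∀ i, Module ℂ (W i)] [∀ i, FiniteDimensional ℂ (W i)]
    (σ : ∀ i, Representation ℂ G (W i)) :
    (tripleMult (σ 0) (σ 1) (σ 2) : ℂ) =
      (Nat.card G : ℂ)⁻¹ * ∑ g, ∏ i, (σ i).character g := by
  have h := average_character (V := (W 0 ⊗[ℂ] W 1) ⊗[ℂ] W 2) (((σ 0).tprod (σ 1)).tprod (σ 2))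
  refine h.symm.trans ?_
  congr 1
  refine Finset.sum_congr rfl fun g _ => ?_
  have h2 := congr_fun (char_tensor (V := W 0 ⊗[ℂ] W 1) ((σ 0).tprod (σ 1)) (σ 2)) g
  rw [Fin.prod_univ_three]
  refine h2.trans ?_
  have h3 := congr_fun (char_tensor (σ 0) (σ 1)) g
  exact congr_arg (· * _) h3

variable {G : Type*} [Group G] {H : Subgroup G} {w : G} {W : Fin 3 → Type*}
  [∀ i, AddCommGroup (W i)] [∀ i, Module ℂ (W i)] [∀ i, FiniteDimensional ℂ (W i)]

/-- One factor vanishing on the nontrivial coset kills that half of the average. The alternative of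
an identically zero factor is kept separate because it does not need `H` nontrivial, and so covers S
for q = 2. -/
lemma IsDihedralTorus.tripleMult_normalizer [Finite G] (hH : IsDihedralTorus H w) [Fintype H]
    (σ : ∀ i, Representation ℂ (Subgroup.normalizer (H : Set G)) (W i)) (i : Fin 3)
    (hi : (∀ n, (σ i).character n = 0) ∨
      Nontrivial H ∧ ∀ n : Subgroup.normalizer (H : Set G), (n : G) * w ∈ H → (σ i).character n = 0) :
    (tripleMult (σ 0) (σ 1) (σ 2) : ℂ) =
      (Nat.card H : ℂ)⁻¹ * (∑ h, ∏ j, (resNormalizer (σ j)).character h) / 2 := by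
  classical
  have := Fintype.ofFinite (Subgroup.normalizer (H : Set G))
  rw [tripleMult_eq_average]
  rcases hi with hi | ⟨hnt, hi⟩
  · rw [Finset.sum_eq_zero fun n _ => Finset.prod_eq_zero (Finset.mem_univ i) (hi n),
      Finset.sum_eq_zero fun h _ => Finset.prod_eq_zero (Finset.mem_univ i) (hi _)]
    simp
  let f : G → ℂ := fun g => if hg : g ∈ Subgroup.normalizer (H : Set G) then
    ∏ j, (σ j).character ⟨g, hg⟩ else 0
  have hf : ∀ n : Subgroup.normalizer (H : Set G), f n = ∏ j, (σ j).character n := fun n =>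
    dif_pos n.2
  have h0 : ∀ h : H, f (h * w) = 0 := fun h => by
    have hmem : (h : G) * w ∈ Subgroup.normalizer (H : Set G) :=
      (hH.mem_normalizer_iff _).2 (Or.inr (by rw [mul_assoc, hH.w_mul_w, mul_one]; exact h.2))
    refine (hf ⟨_, hmem⟩).trans (Finset.prod_eq_zero (Finset.mem_univ i) (hi ⟨_, hmem⟩ ?_))
    change (h : G) * w * w ∈ H
    rw [mul_assoc, hH.w_mul_w, mul_one]
    exact h.2
  have h1 := hH.sum_normalizer f
  rw [Finset.sum_eq_zero fun h _ => h0 h, add_zero] at h1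
  simp only [hf] at h1
  have h2 : ∑ h : H, f h = ∑ h, ∏ j, (resNormalizer (σ j)).character h :=
    Finset.sum_congr rfl fun h _ => hf (Subgroup.inclusion Subgroup.le_normalizer h)
  rw [h1, h2, hH.card_normalizer]
  simp only [Nat.cast_mul, Nat.cast_ofNat, mul_inv]
  ring

lemma nontrivial_of_mul_self_ne_one {A : Type*} [Group A] {χ : A →* ℂˣ} (hχ : χ * χ ≠ 1) :
    Nontrivial A :=
  not_subsingleton_iff_nontrivial.1 fun _ => hχ <| MonoidHom.ext fun x => by
    rw [Subsingleton.elim x 1, map_one, map_one]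

/-- A representation of the normalizer whose restriction is `χ + χ⁻¹`, for a character `χ` which is
not quadratic, has vanishing character off the torus. -/
lemma IsDihedralTorus.character_eq_zero_of_induced (hH : IsDihedralTorus H w) [Finite H]
    {V : Type*} [AddCommGroup V] [Module ℂ V] [FiniteDimensional ℂ V]
    (σ : Representation ℂ (Subgroup.normalizer (H : Set G)) V) {χ : H →* ℂˣ} (hχ : χ * χ ≠ 1)
    (hσ : ∀ h, (resNormalizer σ).character h = χ h + χ h⁻¹) :
    Nontrivial H ∧
      ∀ n : Subgroup.normalizer (H : Set G), (n : G) * w ∈ H → σ.character n = 0 := by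
  have := Fintype.ofFinite H
  refine ⟨nontrivial_of_mul_self_ne_one hχ, fun n hn =>
    hH.character_mul_w_eq_zero σ ?_ n hn⟩
  · have := hH.isMulCommutative
    have h1 := sum_hom_units (χ * χ)
    have h2 := sum_hom_units (χ * χ)⁻¹
    rw [if_neg hχ] at h1
    rw [if_neg fun h => hχ (by
      rw [← inv_inv (χ * χ), h]
      ext
      simp)] at h2
    -- On squares the character is χ² + χ⁻², and both of these nontrivial characters sum to zero.
    rw [Finset.sum_congr rfl fun h _ => hσ (h * h), Finset.sum_add_distrib]
    refine (congr_arg₂ (· + ·) ?_ ?_).trans (add_zero (0 : ℂ))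
    · rw [← h1]
      exact Finset.sum_congr rfl fun h _ => by rw [map_mul]; rfl
    · rw [← h2]
      exact Finset.sum_congr rfl fun h _ => by rw [map_inv, map_mul]; rfl

end TripleMultiplicity

/-! ### Triples of quadratic characters. -/

section QuadraticTriple

variable {F : Type*} [Field F]

lemma prod_sq_eq_one {η : Fin 3 → (Fˣ →* ℂˣ)} (hη : ∀ i, η i ^ 2 = 1) : (∏ i, η i) ^ 2 = 1 := by
  rw [← Finset.prod_pow]
  exact Finset.prod_eq_one fun i _ => hη i

lemma detChar_prod {η : Fin 3 → (Fˣ →* ℂˣ)} (hη : ∀ i, η i ^ 2 = 1) (g : PGL(2, F)) :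
    detChar (∏ i, η i) (prod_sq_eq_one hη) g = ∏ i, detChar (η i) (hη i) g := by
  induction g using ProjGenLinGroup.induction_on with
  | mk g =>
    simp only [detChar_mk]
    rw [MonoidHom.finsetProd_apply]

open scoped Classical in
lemma average_detChar_prod [Finite F] {η : Fin 3 → (Fˣ →* ℂˣ)} (hη : ∀ i, η i ^ 2 = 1)
    {H : Subgroup PGL(2, F)} [Fintype H] (hH : ∏ i, η i ≠ 1 →
      ∃ h ∈ H, detChar (∏ i, η i) (prod_sq_eq_one hη) h ≠ 1) :
    (Nat.card H : ℂ)⁻¹ * ∑ h : H, ∏ i, (detChar (η i) (hη i) h : ℂ) =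
      if ∏ i, η i = 1 then 1 else 0 := by
  have h1 := sum_hom_units (detCharRes H (∏ i, η i) (prod_sq_eq_one hη))
  have h2 : ∀ h : H, (detCharRes H (∏ i, η i) (prod_sq_eq_one hη) h : ℂ) =
      ∏ i, (detChar (η i) (hη i) h : ℂ) := fun h => by
    rw [detCharRes_apply, detChar_prod, Units.coe_prod]
  simp only [h2] at h1
  rw [h1]
  split_ifs with h3 h4 h4
  · exact inv_mul_cancel₀ (NeZero.ne _)
  · obtain ⟨h, hh, hne⟩ := hH h4
    exact absurd (DFunLike.congr_fun h3 ⟨h, hh⟩) hne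
  · refine absurd ?_ h3
    have h5 : ∀ (η : Fˣ →* ℂˣ) (hη : η ^ 2 = 1), η = 1 → detCharRes H η hη = 1 := by
      rintro _ hη rfl
      exact detCharRes_one H
    exact h5 _ _ h4
  · rw [mul_zero]

open scoped Classical in
-- The product of the η_i ∘ det has the same average over `H` and over its normalizer: 1 or 0
-- according to whether the product of the η_i is trivial. Writing this as half plus half isolates
-- an error that does not depend on the torus, and avoids the index of `H` in its normalizer.
lemma tripleMult_detChar [Finite F] {η : Fin 3 → (Fˣ →* ℂˣ)} (hη : ∀ i, η i ^ 2 = 1)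
    {H : Subgroup PGL(2, F)} [Fintype H] (hH : ∀ (η : Fˣ →* ℂˣ) (hη : η ^ 2 = 1), η ≠ 1 →
      detCharRes H η hη ≠ 1) {W : Fin 3 → Type*} [∀ i, AddCommGroup (W i)] [∀ i, Module ℂ (W i)]
    [∀ i, FiniteDimensional ℂ (W i)]
    (σ : ∀ i, Representation ℂ (Subgroup.normalizer (H : Set PGL(2, F))) (W i))
    (hσ : ∀ i n, (σ i).character n = detChar (η i) (hη i) n) :
    (tripleMult (σ 0) (σ 1) (σ 2) : ℂ) =
      (Nat.card H : ℂ)⁻¹ * (∑ h, ∏ j, (resNormalizer (σ j)).character h) / 2 +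
        (if ∏ i, η i = 1 then 1 else 0) / 2 := by
  have := Fintype.ofFinite (Subgroup.normalizer (H : Set PGL(2, F)))
  have hne : ∏ i, η i ≠ 1 → ∃ h ∈ H, detChar (∏ i, η i) (prod_sq_eq_one hη) h ≠ 1 := by
    intro h1
    by_contra! h2
    exact hH _ (prod_sq_eq_one hη) h1 (MonoidHom.ext fun h => h2 h h.2)
  have h1 := average_detChar_prod hη hne
  have h2 := average_detChar_prod hη (H := Subgroup.normalizer (H : Set PGL(2, F))) fun h =>
    let ⟨x, hx, hx'⟩ := hne h
    ⟨x, Subgroup.le_normalizer hx, hx'⟩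
  rw [tripleMult_eq_average]
  have h3 : ∀ h : H, ∏ j, (resNormalizer (σ j)).character h =
      ∏ i, (detChar (η i) (hη i) h : ℂ) := fun h =>
    Finset.prod_congr rfl fun j _ => hσ j _
  simp only [hσ, h3]
  rw [h1, h2]
  ring

end QuadraticTriple

/-! ### Existence of the associated representations. -/

section Associated

variable {F : Type*} [Field F] [Finite F] {T : Subgroup PGL(2, F)}
  {V : Type*} [AddCommGroup V] [Module ℂ V] [FiniteDimensional ℂ V]
  {π : Representation ℂ PGL(2, F) V} {a : ℂ} {k : splitTorus F → ℂ} {l : T → ℂ}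

section

variable {W : Type*} [AddCommGroup W] [Module ℂ W]

omit [Finite F] in
lemma IsAssociatedSplit.finiteDimensional
    {σ : Representation ℂ (Subgroup.normalizer (splitTorus F : Set PGL(2, F))) W}
    (h : IsAssociatedSplit π σ) : FiniteDimensional ℂ W := by
  obtain ⟨e⟩ := h.restriction
  exact Module.Finite.of_injective (e.symm.toLinearMap ∘ₗ LinearMap.inr ℂ _ W)
    (e.symm.toLinearEquiv.injective.comp LinearMap.inr_injective)

omit [FiniteDimensional ℂ V] in
lemma IsAssociatedNonsplit.finiteDimensional
    {τ : Representation ℂ (Subgroup.normalizer (T : Set PGL(2, F))) W}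
    (h : IsAssociatedNonsplit π τ) : FiniteDimensional ℂ W := by
  obtain ⟨e⟩ := h.restriction
  exact Module.Finite.of_injective (e.toLinearMap ∘ₗ LinearMap.inr ℂ V W)
    (e.toLinearEquiv.injective.comp LinearMap.inr_injective)

variable [FiniteDimensional ℂ W]

lemma TorusData.nonempty_equiv_split_iff (hπ : TorusData T π.character 1 a k l)
    (σ : Representation ℂ (Subgroup.normalizer (splitTorus F : Set PGL(2, F))) W) :
    Nonempty ((res π (splitTorus F)).Equiv
      ((Representation.leftRegular ℂ (splitTorus F)).prod (resNormalizer σ))) ↔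
      ∀ s, (resNormalizer σ).character s = k s := by
  classical
  have key : ∀ s : splitTorus F,
      ((Representation.leftRegular ℂ (splitTorus F)).prod (resNormalizer σ)).character s =
        (if s = 1 then 1 * ((Nat.card F : ℂ) - 1) else 0) + (resNormalizer σ).character s := by
    intro s
    rw [character_prod, Pi.add_apply, character_leftRegular, card_splitTorus_complex, one_mul]
  refine ⟨fun ⟨e⟩ s => ?_, fun h => equiv_of_character_eq _ _ (funext fun s => ?_)⟩
  · have h1 := congr_fun (char_iso e) s
    rw [key] at h1
    have h2 : (res π (splitTorus F)).character s = _ := hπ.split s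
    linear_combination h2 - h1
  · rw [key, h]
    exact (hπ.split s).trans (add_comm _ _)

lemma TorusData.nonempty_equiv_nonsplit_iff (hT : IsNonsplitTorus T)
    (hπ : TorusData T π.character 1 a k l)
    (τ : Representation ℂ (Subgroup.normalizer (T : Set PGL(2, F))) W) :
    Nonempty (((res π T).prod (resNormalizer τ)).Equiv (Representation.leftRegular ℂ T)) ↔
      ∀ t, (resNormalizer τ).character t = l t := by
  classical
  have key : ∀ t : T, ((res π T).prod (resNormalizer τ)).character t =
      (if t = 1 then 1 * ((Nat.card F : ℂ) + 1) else 0) - l t + (resNormalizer τ).character t := by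
    intro t
    rw [character_prod, Pi.add_apply, ← hπ.nonsplit t]
    rfl
  have key' : ∀ t : T, (Representation.leftRegular ℂ T).character t =
      if t = 1 then 1 * ((Nat.card F : ℂ) + 1) else 0 := fun t => by
    rw [character_leftRegular, hT.card_complex, one_mul]
  refine ⟨fun ⟨e⟩ t => ?_, fun h => equiv_of_character_eq _ _ (funext fun t => ?_)⟩
  · have h1 := congr_fun (char_iso e) t
    rw [key, key'] at h1
    linear_combination h1
  · rw [key, key', h]
    ring

end

omit [FiniteDimensional ℂ V] in
lemma steinbergNormalized_of_ne_zero (hT : IsNonsplitTorus T)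
    (hπ : TorusData T π.character 1 a k l) (ha : a ≠ 0) {N : Subgroup PGL(2, F)} {W : Type*}
    [AddCommGroup W] [Module ℂ W] (σ : Representation ℂ N W) : SteinbergNormalized π σ :=
  fun _ _ h => absurd (hπ.eq_zero_of_isSteinbergTwist hT h).1 ha

omit [FiniteDimensional ℂ V] in
-- The normalization quantifies over every η' for which π is a twist, but k determines η' through
-- its restriction to S, so only η can occur.
lemma exists_steinbergNormalized (hT : IsNonsplitTorus T) {η : Fˣ →* ℂˣ} {hη : η ^ 2 = 1}
    (hπ : TorusData T π.character 1 a k l) (hk : ∀ s, k s = detCharRes (splitTorus F) η hη s)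
    (N : Subgroup PGL(2, F)) :
    ∃ (n : ℕ) (σ : Representation ℂ N (Fin n → ℂ)), SteinbergNormalized π σ ∧
      ∀ x, σ.character x = detChar η hη x := by
  obtain ⟨n, σ, ⟨e⟩⟩ := exists_equiv_fin (charRep ((detChar η hη).comp N.subtype))
  refine ⟨n, σ, fun η' hη' h => ?_, fun x => ?_⟩
  · have h1 := (hπ.eq_zero_of_isSteinbergTwist hT h).2
    obtain rfl : η = η' := detCharRes_split_injective (hη := hη) (hη' := hη') <|
      MonoidHom.ext fun s => Units.ext ((hk s).symm.trans (h1 s))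
    exact ⟨e.symm⟩
  · rw [← char_iso e, character_charRep]
    rfl

omit [Finite F] in
lemma exists_character_eq_zero (N : Subgroup PGL(2, F)) :
    ∃ (n : ℕ) (σ : Representation ℂ N (Fin n → ℂ)), ∀ x, σ.character x = 0 :=
  ⟨0, 1, fun x => character_eq_zero_of_subsingleton _ x⟩

theorem exists_isAssociatedSplit (hT : IsNonsplitTorus T) (hπ : TorusData T π.character 1 a k l)
    (htype : GenericType T a k l) :
    ∃ (n : ℕ) (σ : Representation ℂ
      (Subgroup.normalizer (splitTorus F : Set PGL(2, F))) (Fin n → ℂ)), IsAssociatedSplit π σ := by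
  rcases htype with ⟨χ, hχ, ha, hk, -⟩ | ⟨η, hη, ha, hk, -⟩ | ⟨-, -, ha, hk, -⟩
  · have := nontrivial_of_mul_self_ne_one hχ
    obtain ⟨σ, hσ⟩ := (isDihedralTorus_splitTorus (F := F)).exists_induced χ
    exact ⟨2, σ, (hπ.nonempty_equiv_split_iff σ).2 fun s => (hσ s).trans (hk s).symm,
      steinbergNormalized_of_ne_zero hT hπ (by simp [ha]) σ⟩
  · obtain ⟨n, σ, h1, h2⟩ := exists_steinbergNormalized hT hπ hk _
    exact ⟨n, σ, (hπ.nonempty_equiv_split_iff σ).2 fun s => (h2 _).trans (hk s).symm, h1⟩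
  · obtain ⟨n, σ, hσ⟩ := exists_character_eq_zero
      (Subgroup.normalizer (splitTorus F : Set PGL(2, F)))
    exact ⟨n, σ, (hπ.nonempty_equiv_split_iff σ).2 fun s => (hσ _).trans (hk s).symm,
      steinbergNormalized_of_ne_zero hT hπ (by simp [ha]) σ⟩

theorem exists_isAssociatedNonsplit (hT : IsNonsplitTorus T)
    (hπ : TorusData T π.character 1 a k l) (htype : GenericType T a k l) :
    ∃ (n : ℕ) (τ : Representation ℂ (Subgroup.normalizer (T : Set PGL(2, F))) (Fin n → ℂ)),
      IsAssociatedNonsplit π τ := by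
  rcases htype with ⟨-, -, ha, -, hl⟩ | ⟨η, hη, ha, hk, hl⟩ | ⟨χ, hχ, ha, -, hl⟩
  · obtain ⟨n, τ, hτ⟩ := exists_character_eq_zero (Subgroup.normalizer (T : Set PGL(2, F)))
    exact ⟨n, τ, (hπ.nonempty_equiv_nonsplit_iff hT τ).2 fun t => (hτ _).trans (hl t).symm,
      steinbergNormalized_of_ne_zero hT hπ (by simp [ha]) τ⟩
  · obtain ⟨n, τ, h1, h2⟩ := exists_steinbergNormalized hT hπ hk _
    exact ⟨n, τ, (hπ.nonempty_equiv_nonsplit_iff hT τ).2 fun t => (h2 _).trans (hl t).symm, h1⟩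
  · obtain ⟨w, hw⟩ := hT.exists_isDihedralTorus
    have := nontrivial_of_mul_self_ne_one hχ
    obtain ⟨τ, hτ⟩ := hw.exists_induced χ
    exact ⟨2, τ, (hπ.nonempty_equiv_nonsplit_iff hT τ).2 fun t => (hτ t).trans (hl t).symm,
      steinbergNormalized_of_ne_zero hT hπ (by simp [ha]) τ⟩

end Associated

lemma character_eq_zero_of_apply_one {G V : Type*} [Group G] [AddCommGroup V] [Module ℂ V]
    [FiniteDimensional ℂ V] (ρ : Representation ℂ G V) (h : ρ.character 1 = 0) (g : G) :
    ρ.character g = 0 := by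
  rw [char_one, Nat.cast_eq_zero] at h
  have := Module.finrank_zero_iff.1 h
  exact character_eq_zero_of_subsingleton ρ g

/-! ### The three multiplicities compared. -/

section Multiplicities

variable {F : Type*} [Field F] [Finite F] {T : Subgroup PGL(2, F)} (hT : IsNonsplitTorus T)
  {V : Fin 3 → Type*} [∀ i, AddCommGroup (V i)] [∀ i, Module ℂ (V i)]
  [∀ i, FiniteDimensional ℂ (V i)] {π : ∀ i, Representation ℂ PGL(2, F) (V i)}
  {a : Fin 3 → ℂ} {k : Fin 3 → splitTorus F → ℂ} {l : Fin 3 → T → ℂ}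
  {W : Fin 3 → Type*} [∀ i, AddCommGroup (W i)] [∀ i, Module ℂ (W i)]
  {X : Fin 3 → Type*} [∀ i, AddCommGroup (X i)] [∀ i, Module ℂ (X i)]
  {σ : ∀ i, Representation ℂ (Subgroup.normalizer (splitTorus F : Set PGL(2, F))) (W i)}
  {τ : ∀ i, Representation ℂ (Subgroup.normalizer (T : Set PGL(2, F))) (X i)}
include hT

lemma tripleMult_eq_torus [Fintype (splitTorus F)] [Fintype T]
    (hπ : ∀ i, TorusData T (π i).character 1 (a i) (k i) (l i)) :
    (tripleMult (π 0) (π 1) (π 2) : ℂ) =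
      1 + ((Nat.card (splitTorus F) : ℂ)⁻¹ * ∑ s, ∏ i, k i s -
        (Nat.card T : ℂ)⁻¹ * ∑ t, ∏ i, l i t) / 2 := by
  have := Fintype.ofFinite PGL(2, F)
  rw [tripleMult_eq_average]
  simp only [Fin.prod_univ_three]
  exact (hπ 0).average_mul_mul hT (hπ 1) (hπ 2)

/-- The multiplicities for the normalizers are half the averages over the tori of the products of
the characters, up to a correction which is the same for both tori. -/
lemma exists_tripleMult_normalizer [Fintype (splitTorus F)] [Fintype T]
    (hirr : ∀ i, (π i).IsIrreducible)
    (hπ : ∀ i, TorusData T (π i).character 1 (a i) (k i) (l i))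
    (htype : ∀ i, GenericType T (a i) (k i) (l i)) (hσ : ∀ i, IsAssociatedSplit (π i) (σ i))
    (hτ : ∀ i, IsAssociatedNonsplit (π i) (τ i)) :
    ∃ δ : ℂ, (tripleMult (σ 0) (σ 1) (σ 2) : ℂ) =
        (Nat.card (splitTorus F) : ℂ)⁻¹ * (∑ s, ∏ i, k i s) / 2 + δ ∧
      (tripleMult (τ 0) (τ 1) (τ 2) : ℂ) = (Nat.card T : ℂ)⁻¹ * (∑ t, ∏ i, l i t) / 2 + δ := by
  classical
  have hW := fun i => (hσ i).finiteDimensional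
  have hX := fun i => (hτ i).finiteDimensional
  have hk := fun i => ((hπ i).nonempty_equiv_split_iff (σ i)).1 (hσ i).restriction
  have hl := fun i => ((hπ i).nonempty_equiv_nonsplit_iff hT (τ i)).1 (hτ i).restriction
  have hS := isDihedralTorus_splitTorus (F := F)
  obtain ⟨w, hw⟩ := hT.exists_isDihedralTorus
  simp only [← hk, ← hl]
  -- If all three are Steinberg twists, the prescribed extensions to the normalizers fix the error.
  -- Otherwise a single index i of another type makes the error zero for both tori, whatever
  -- extensions were chosen.
  by_cases hst : ∀ i, ∃ (η : Fˣ →* ℂˣ) (hη : η ^ 2 = 1), a i = 0 ∧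
      (∀ s, k i s = detCharRes (splitTorus F) η hη s) ∧ ∀ t, l i t = detCharRes T η hη t
  · choose η hη ha hkη hlη using hst
    have htw : ∀ i, IsSteinbergTwist (π i) (η i) (hη i) := fun i => by
      have := hirr i
      have h := hπ i
      rw [ha i, funext (hkη i), funext (hlη i)] at h
      exact h.isSteinbergTwist hT
    refine ⟨_, tripleMult_detChar hη (fun η hη h1 h2 => h1 ?_) σ fun i n => ?_,
      tripleMult_detChar hη (fun η hη h1 => detCharRes_nonsplit_ne_one hT hη h1) τ fun i n => ?_⟩
    · exact detCharRes_split_injective (hη := hη) (hη' := one_sq_monoidHom)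
        (h2.trans (detCharRes_one _).symm)
    · obtain ⟨e⟩ := (hσ i).normalized (η i) (hη i) (htw i)
      rw [char_iso e, character_charRep]
      rfl
    · obtain ⟨e⟩ := (hτ i).normalized (η i) (hη i) (htw i)
      rw [char_iso e, character_charRep]
      rfl
  · push Not at hst
    obtain ⟨i, hi⟩ := hst
    refine ⟨0, ?_, ?_⟩
    · rw [add_zero]
      refine hS.tripleMult_normalizer σ i ?_
      rcases htype i with ⟨χ, hχ, -, hkχ, -⟩ | ⟨η, hη, ha, hkη, hlη⟩ | ⟨-, -, -, hk0, -⟩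
      · exact Or.inr (hS.character_eq_zero_of_induced (σ i) hχ fun s => (hk i s).trans (hkχ s))
      · obtain ⟨t, ht⟩ := hi η hη ha hkη
        exact absurd (hlη t) ht
      · exact Or.inl (character_eq_zero_of_apply_one (σ i) ((hk i 1).trans (hk0 1)))
    · rw [add_zero]
      refine hw.tripleMult_normalizer τ i ?_
      rcases htype i with ⟨-, -, -, -, hl0⟩ | ⟨η, hη, ha, hkη, hlη⟩ | ⟨χ, hχ, -, -, hlχ⟩
      · exact Or.inl (character_eq_zero_of_apply_one (τ i) ((hl i 1).trans (hl0 1)))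
      · obtain ⟨t, ht⟩ := hi η hη ha hkη
        exact absurd (hlη t) ht
      · exact Or.inr (hw.character_eq_zero_of_induced (τ i) hχ fun t => (hl i t).trans (hlχ t))

end Multiplicities

end FinitePGLTwo

end

theorem theorem3p3 {F : Type*} [Field F] [Finite F]
    (T : Subgroup PGL(2, F)) (hT : FinitePGLTwo.IsNonsplitTorus T)
    (V : Fin 3 → Type*) [∀ i, AddCommGroup (V i)] [∀ i, Module ℂ (V i)]
    [∀ i, FiniteDimensional ℂ (V i)]
    (π : ∀ i, Representation ℂ PGL(2, F) (V i))
    (hirr : ∀ i, (π i).IsIrreducible) (hgen : ∀ i, FinitePGLTwo.IsGeneric (π i)) :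
    (∀ i,
      (∃ (n : ℕ) (σ : Representation ℂ
          (Subgroup.normalizer (FinitePGLTwo.splitTorus F : Set PGL(2, F))) (Fin n → ℂ)),
        FinitePGLTwo.IsAssociatedSplit (π i) σ) ∧
      (∃ (n : ℕ) (τ : Representation ℂ
          (Subgroup.normalizer (T : Set PGL(2, F))) (Fin n → ℂ)),
        FinitePGLTwo.IsAssociatedNonsplit (π i) τ)) ∧
    ∀ (W : Fin 3 → Type*) [∀ i, AddCommGroup (W i)] [∀ i, Module ℂ (W i)]
      (X : Fin 3 → Type*) [∀ i, AddCommGroup (X i)] [∀ i, Module ℂ (X i)]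
      (σ : ∀ i, Representation ℂ
        (Subgroup.normalizer (FinitePGLTwo.splitTorus F : Set PGL(2, F))) (W i))
      (τ : ∀ i, Representation ℂ (Subgroup.normalizer (T : Set PGL(2, F))) (X i)),
      (∀ i, FinitePGLTwo.IsAssociatedSplit (π i) (σ i)) →
      (∀ i, FinitePGLTwo.IsAssociatedNonsplit (π i) (τ i)) →
      (FinitePGLTwo.tripleMult (π 0) (π 1) (π 2) : ℤ)
        - (FinitePGLTwo.tripleMult (σ 0) (σ 1) (σ 2) : ℤ)
        + (FinitePGLTwo.tripleMult (τ 0) (τ 1) (τ 2) : ℤ) = 1 := by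

  have := Fintype.ofFinite (FinitePGLTwo.splitTorus F)
  have := Fintype.ofFinite T
  choose a k l hπ htype using fun i =>
    have := hirr i
    FinitePGLTwo.exists_genericType (π i) hT (hirr i) (hgen i)
  refine ⟨fun i => ⟨FinitePGLTwo.exists_isAssociatedSplit hT (hπ i) (htype i),
    FinitePGLTwo.exists_isAssociatedNonsplit hT (hπ i) (htype i)⟩, ?_⟩
  intro W _ _ X _ _ σ τ hσ hτ
  have h1 := FinitePGLTwo.tripleMult_eq_torus hT hπ
  obtain ⟨δ, h2, h3⟩ := FinitePGLTwo.exists_tripleMult_normalizer hT hirr hπ htype hσ hτ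
  have h4 : ((FinitePGLTwo.tripleMult (π 0) (π 1) (π 2) : ℤ) : ℂ)
      - ((FinitePGLTwo.tripleMult (σ 0) (σ 1) (σ 2) : ℤ) : ℂ)
      + ((FinitePGLTwo.tripleMult (τ 0) (τ 1) (τ 2) : ℤ) : ℂ) = 1 := by
    push_cast
    rw [h1, h2, h3]
    ring
  exact_mod_cast h4
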